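/- **Definitions.** An *algebraic theory* $\mathbb T=(\Sigma,E)$ is a set $\Sigma$ of symbols with finite arities and a set $E$ of pairs of $\Sigma$-terms over a countable set of variables. Its *term monad* $T_{\mathbb T}\colon \mathbf{Set}\to\mathbf{Set}$ sends a set $X$ to the set of $\Sigma$-terms with variables in $X$ modulo the congruence generated by the substitution instances of $E$; the unit is the inclusion of variables, the multiplication is substitution. The *Lawvere theory* $\mathbf L_{\mathbb T}$ has the natural numbers as objects; an arrow $n\to m$ is an $m$-tuple of $E$-classes of terms in $x_1,\dots,x_n$, and composition is substitution; the categorical product of $n$ and $m$ is $n+m$. Let $\aleph_0$ be the category of natural numbers $n$ and functions $\{0,\dots,n-1\}\to\{0,\dots,m-1\}$, and let $d\colon\aleph_0\to\mathbf L_{\mathbb T}^{op}$ be the identity-on-objects functor which sends a function to the corresponding tuple of variables. A monad $T$ on $(\mathbf{Set},\times,1)$ is *symmetric monoidal* if it is equipped with a natural transformation $m_{X,Y}\colon TX\times TY\to T(X\times Y)$ that is compatible with the unit and the multiplication of $T$ and with the associators, unitors and symmetries of $\times$. A *copy-discard category* is a symmetric monoidal category $(\mathbf C,\otimes,1)$ in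 which every object $X$ carries a cocommutative comonoid $(\mathrm{copy}_X\colon X\to X\otimes X,\ \mathrm{discard}_X\colon X\to 1)$, coherently with the monoidal structure. A *finite coproduct (fc) category* is a symmetric monoidal category $(\mathbf C,\oplus,0)$ in which every object $X$ carries a commutative monoid $(\nabla_X\colon X\oplus X\to X,\ !_X\colon 0\to X)$, coherently with the monoidal structure and naturally in $X$; a *morphism* of fc categories is a strong symmetric monoidal functor that preserves these monoids. $\mathbf L_{\mathbb T}^{op}$ is an fc category with $n\oplus m=n+m$. A *rig category* has two symmetric monoidal structures $(\otimes,1)$ and $(\oplus,0)$ and natural isomorphisms $\delta^l\colon X\otimes(Y\oplus Z)\to (X\otimes Y)\oplus(X\otimes Z)$, $\delta^r\colon (X\oplus Y)\otimes Z\to (X\otimes Z)\oplus(Y\otimes Z)$, $0\otimes X\to 0$ and $X\otimes 0\to 0$, subject to Laplaza's coherence axioms. An *fc-cd rig category* is a rig category with $(\oplus,0)$ an fc category and $(\otimes,1)$ a copy-discard category such that $$\mathrm{discard}_{X\oplus Y}=\nabla_1\circ(\mathrm{discard}_X\oplus\mathrm{discard}_Y),$$ and such that $\mathrm{copy}_{X\oplus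 Y}$ is the composite $$X\oplus Y\cong (X\oplus 0)\oplus(0\oplus Y)\xrightarrow{(\mathrm{copy}_X\oplus !_{X\otimes Y})\oplus(!_{Y\otimes X}\oplus \mathrm{copy}_Y)}\big((X\otimes X)\oplus(X\otimes Y)\big)\oplus\big((Y\otimes X)\oplus (Y\otimes Y)\big)\cong (X\oplus Y)\otimes(X\oplus Y),$$ where the last isomorphism is given by the inverses of the distributors. In a rig category let $\overline 0=0$, $\overline 1=1$ and $\overline{n+1}=1\oplus\overline n$ for $n\ge 1$. If $(\oplus,0)$ is an fc category, let $c\colon\aleph_0\to\mathbf C$ be the canonical functor with $c(n)=\overline n$, which sends a function to the cotuple of the injections that it selects. A *$\mathbb T$-copy-discard rig category* is an fc-cd rig category $\mathbf C$ together with a morphism of fc categories $i\colon\mathbf L_{\mathbb T}^{op}\to\mathbf C$ such that $i\circ d=c$. **Proposition.** Let $\mathbb T$ be an algebraic theory and let $T_{\mathbb T}$ be equipped with the structure $m$ of a symmetric monoidal monad on $(\mathbf{Set},\times,1)$. Then the Kleisli category $\mathbf{Set}_{T_{\mathbb T}}$ is a $\mathbb T$-copy-discard rig category, where $X\otimes Y=X\times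 Y$ with $f\otimes g=m\circ(f\times g)$, where $X\oplus Y$ is the disjoint union, and where the associators, unitors, symmetries, distributors, annihilators, comonoids and monoids are the images of the evident functions under the canonical functor $\mathbf{Set}\to\mathbf{Set}_{T_{\mathbb T}}$ (for instance $\mathrm{copy}_X$ is the image of $x\mapsto(x,x)$ and $\nabla_X$ is the image of the codiagonal function). The structure map $i$ comes from the identification of $\mathbf L_{\mathbb T}^{op}$ with the restriction of $\mathbf{Set}_{T_{\mathbb T}}$ to finite ordinals. That is, let $i_0\colon\mathbf L_{\mathbb T}^{op}\to\mathbf{Set}_{T_{\mathbb T}}$ be the functor which sends $n$ to $\{0,\dots,n-1\}$ and a tuple $\langle t_1,\dots,t_n\rangle\colon m\to n$ of $\mathbf L_{\mathbb T}$ to the function $k\mapsto t_{k+1}$ from $\{0,\dots,n-1\}$ to $T_{\mathbb T}(\{0,\dots,m-1\})$. Then $i_0$ is full, faithful and injective on objects, it is a morphism of fc categories, and $i_0\circ d$ is the composite $\aleph_0\to\mathbf{Set}\to\mathbf{Set}_{T_{\mathbb T}}$ of the canonical functors. Moreover there is a natural isomorphism $i\cong i_0$ whose component at $n$ is the canonical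 isomorphism $\overline n=1\oplus(1\oplus\cdots\oplus 1)\cong\{0,\dots,n-1\}$, which sends the $k$-th summand to the element $k$. -/

import Mathlib

set_option linter.unusedSimpArgs false
set_option linter.unusedSectionVars false

open CategoryTheory MonoidalCategory

universe u v w v₁ u₁ v₂ u₂

namespace TRig

/-- A cartesian signature: a set of symbols with an arity function. -/
structure Signature where
  Symb : Type u
  ar : Symb → ℕ

/-- Terms over the signature `S` with variables in `X`. -/
inductive Term (S : Signature.{u}) (X : Type v) : Type (max u v)
  | var : X → Term S X
  | op : (f : S.Symb) → (Fin (S.ar f) → Term S X) → Term S X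

/-- Simultaneous substitution of terms for variables. -/
def Term.subst {S : Signature.{u}} {X : Type v} {Y : Type w} (σ : X → Term S Y) :
    Term S X → Term S Y
  | .var x => σ x
  | .op f a => .op f (fun i => (a i).subst σ)

/-- An algebraic theory `(Σ, E)`: a signature and a set of pairs of terms over a countable set
of variables. -/
structure AlgebraicTheory extends Signature.{u} where
  E : Set (Term toSignature ℕ × Term toSignature ℕ)

/-- The congruence on terms generated by all substitution instances of the equations in `E`. -/
inductive Term.Eqv (T : AlgebraicTheory.{u}) {X : Type v} :
    Term T.toSignature X → Term T.toSignature X → Prop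
  | refl (t) : Eqv T t t
  | symm {s t} : Eqv T s t → Eqv T t s
  | trans {r s t} : Eqv T r s → Eqv T s t → Eqv T r t
  | congr (f : T.Symb) {a b : Fin (T.ar f) → Term T.toSignature X} :
      (∀ i, Eqv T (a i) (b i)) → Eqv T (.op f a) (.op f b)
  | ax {s t : Term T.toSignature ℕ} : (s, t) ∈ T.E → ∀ σ : ℕ → Term T.toSignature X,
      Eqv T (s.subst σ) (t.subst σ)

def Term.setoid (T : AlgebraicTheory.{u}) (X : Type v) : Setoid (Term T.toSignature X) :=
  ⟨Term.Eqv T, .refl, .symm, .trans⟩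

/-- `E`-equivalence classes of terms with variables in `X`. -/
def Cls (T : AlgebraicTheory.{u}) (X : Type v) : Type (max u v) := Quotient (Term.setoid T X)

namespace Cls

variable {T : AlgebraicTheory.{u}} {X Y Z : Type*}

/-- The class of a term. -/
def mk (t : Term T.toSignature X) : Cls T X := Quotient.mk (Term.setoid T X) t

/-- The class of a variable. -/
def var (x : X) : Cls T X := mk (.var x)

theorem exists_rep (k : X → Cls T Y) :
    ∃ σ : X → Term T.toSignature Y, (fun x => mk (σ x)) = k :=
  ⟨fun x => (k x).out, funext fun x => Quotient.out_eq (k x)⟩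

/-- The operation on classes induced by a symbol. -/
noncomputable def op (f : T.Symb) (a : Fin (T.ar f) → Cls T X) : Cls T X :=
  mk (.op f fun i => (a i).out)

theorem op_mk (f : T.Symb) (a : Fin (T.ar f) → Term T.toSignature X) :
    op f (fun i => mk (a i)) = mk (.op f a) :=
  Quotient.sound (s := Term.setoid T X) (.congr f fun i => Quotient.mk_out (s := Term.setoid T X) (a i))

/-- The value of a term under an assignment of classes to variables. -/
noncomputable def eval (k : X → Cls T Y) : Term T.toSignature X → Cls T Y
  | .var x => k x
  | .op f a => op f fun i => eval k (a i)

theorem eval_mk (σ : X → Term T.toSignature Y) (t : Term T.toSignature X) :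
    eval (fun x => mk (σ x)) t = mk (t.subst σ) := by
  induction t with
  | var x => rfl
  | op f a ih => simp only [eval, ih, op_mk, Term.subst]

theorem eval_subst (k : Y → Cls T Z) (σ : X → Term T.toSignature Y) (t : Term T.toSignature X) :
    eval k (t.subst σ) = eval (fun x => eval k (σ x)) t := by
  induction t with
  | var x => rfl
  | op f a ih => simp only [eval, ih, Term.subst]

theorem eval_eqv (k : X → Cls T Y) {s t : Term T.toSignature X} (h : Term.Eqv T s t) :
    eval k s = eval k t := by
  induction h with
  | refl => rfl
  | symm _ ih => exact ih.symm
  | trans _ _ ih₁ ih₂ => exact ih₁.trans ih₂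
  | congr f _ ih => simp only [eval, ih]
  | ax h σ =>
    obtain ⟨τ, hτ⟩ := exists_rep fun n => eval k (σ n)
    rw [eval_subst, eval_subst, ← hτ, eval_mk, eval_mk]
    exact Quotient.sound (s := Term.setoid T _) (.ax h τ)

/-- Substitution on classes: `bind k [t] = t[k(x)/x]`. -/
noncomputable def bind (k : X → Cls T Y) : Cls T X → Cls T Y :=
  Quotient.lift (eval k) fun _ _ h => eval_eqv k h

@[simp] theorem bind_var (k : X → Cls T Y) (x : X) : bind k (var x) = k x := rfl

@[simp] theorem bind_mk (σ : X → Term T.toSignature Y) (t : Term T.toSignature X) :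
    bind (fun x => mk (σ x)) (mk t) = mk (t.subst σ) := eval_mk σ t

theorem var_bind (c : Cls T X) : bind var c = c := by
  refine Quotient.inductionOn c fun t => ?_
  change bind (fun x => mk (.var x)) (mk t) = mk t
  rw [bind_mk]
  congr 1
  induction t with
  | var x => rfl
  | op f a ih => simp only [Term.subst, ih]

theorem bind_bind (k : X → Cls T Y) (l : Y → Cls T Z) (c : Cls T X) :
    bind l (bind k c) = bind (fun x => bind l (k x)) c := by
  obtain ⟨σ, rfl⟩ := exists_rep k
  refine Quotient.inductionOn c fun t => ?_
  change bind l (bind _ (mk t)) = bind _ (mk t)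
  rw [bind_mk]
  exact eval_subst l σ t

end Cls

/-- The term monad on sets: `X` is sent to the set of `E`-equivalence classes of terms with
variables in `X`, the unit is the inclusion of variables and the multiplication is substitution. -/
noncomputable def termMonad (T : AlgebraicTheory.{u}) : Monad (Type u) where
  obj X := Cls T X
  map f := ↾(Cls.bind fun x => Cls.var (f x))
  map_id X := by ext c; exact Cls.var_bind c
  map_comp f g := by
    ext c
    simp [Cls.bind_bind]
  η := { app := fun X => ↾(Cls.var : X → Cls T X)
         naturality := fun X Y f => by ext; simp }
  μ := { app := fun X => ↾(Cls.bind fun c : Cls T X => c)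
         naturality := fun X Y f => by ext; simp [Cls.bind_bind] }
  assoc X := by ext c; simp [Cls.bind_bind]
  left_unit X := by ext c; simp
  right_unit X := by
    ext c
    simp only [Functor.comp_obj, Functor.id_obj]
    simp [Cls.bind_bind, Cls.var_bind]

/-- The Lawvere theory of `T`: the objects are the natural numbers. -/
structure Lawvere (T : AlgebraicTheory.{u}) where
  len : ℕ

namespace Lawvere

variable {T : AlgebraicTheory.{u}}

/-- A morphism `n ⟶ m` is an `m`-tuple of classes of terms in the variables `x₁, …, xₙ`;
composition is substitution. -/
noncomputable instance : Category (Lawvere T) where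
  Hom n m := Fin m.len → Cls T (Fin n.len)
  id _ := fun i => Cls.var i
  comp t s := fun i => Cls.bind t (s i)
  id_comp t := funext fun i => Cls.var_bind (t i)
  comp_id _ := rfl
  assoc t s r := funext fun i => (Cls.bind_bind s t (r i)).symm

open Limits in
/-- The categorical product of `n` and `m` is `n + m`, the terminal object is `0`. -/
noncomputable instance : CartesianMonoidalCategory (Lawvere T) :=
  CartesianMonoidalCategory.ofChosenFiniteProducts
    { cone := asEmptyCone ⟨0⟩
      isLimit := IsTerminal.ofUniqueHom (fun _ => Fin.elim0) fun _ _ => funext fun i => i.elim0 }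
    fun n m =>
      { cone := BinaryFan.mk (P := ⟨n.len + m.len⟩)
          (fun i => Cls.var (Fin.castAdd m.len i)) (fun j => Cls.var (Fin.natAdd n.len j))
        isLimit := BinaryFan.isLimitMk
          (fun s => Fin.append (show Fin n.len → Cls T (Fin s.pt.len) from s.fst) s.snd)
          (fun s => funext fun i => Fin.append_left _ _ i)
          (fun s => funext fun i => Fin.append_right _ _ i)
          (fun s f h₁ h₂ => funext fun i => by
            refine Fin.addCases (fun i => ?_) (fun j => ?_) i
            · exact (congrFun h₁ i).trans (Fin.append_left _ _ i).symm
            · exact (congrFun h₂ j).trans (Fin.append_right _ _ j).symm) }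

noncomputable instance : BraidedCategory (Lawvere T) := .ofCartesianMonoidalCategory

end Lawvere

/-- The category of finite ordinals and functions. -/
structure Aleph0 where
  len : ℕ

instance : Category Aleph0 where
  Hom n m := Fin n.len → Fin m.len
  id _ := id
  comp f g := g ∘ f

/-- The identity-on-objects functor from finite ordinals to the opposite of the Lawvere theory:
a function `f : n → m` is sent to the tuple of variables `(x_{f 0}, …, x_{f (n-1)})`. -/
noncomputable def ordToLawvere (T : AlgebraicTheory.{u}) : Aleph0 ⥤ (Lawvere T)ᵒᵖ where
  obj n := .op ⟨n.len⟩
  map {n m} f := Quiver.Hom.op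
    (show (⟨m.len⟩ : Lawvere T) ⟶ ⟨n.len⟩ from fun i => Cls.var (f i))
  map_id _ := rfl
  map_comp _ _ := rfl

/-- The functor `(Lawvere T)ᵒᵖ ⥤ Set_T` which sends `n` to the ordinal `{0, …, n-1}` and a tuple of
`n` classes of terms in `m` variables to the same tuple, seen as a function from `n` to the value
of the term monad at `m`. -/
noncomputable def lawvereToKleisli (T : AlgebraicTheory.{u}) :
    (Lawvere T)ᵒᵖ ⥤ Kleisli (termMonad T) where
  obj n := .mk _ (ULift.{u} (Fin n.unop.len))
  map t := .mk (↾fun i => Cls.bind (fun j => Cls.var (ULift.up j)) (t.unop i.down))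
  map_id n := by
    apply Kleisli.hom_ext
    ext i
    rfl
  map_comp t s := by
    apply Kleisli.hom_ext
    ext i
    change Cls.bind _ (Cls.bind s.unop (t.unop i.down)) =
      Cls.bind (fun c => c) (Cls.bind (fun x : ULift (Fin _) => Cls.var (Cls.bind _ (s.unop x.down))) (Cls.bind _ _))
    simp [Cls.bind_bind]

/-- The embedding of finite ordinals in sets. -/
def ordToSet : Aleph0 ⥤ Type u where
  obj n := ULift.{u} (Fin n.len)
  map f := ↾fun i => ULift.up (f i.down)

section FC

variable (C : Type u₁) [Category.{v₁} C] [MonoidalCategory C] [SymmetricCategory C]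

open scoped MonObj

/-- A finite coproduct category: a symmetric monoidal category in which every object carries a
commutative monoid (`η[X]` is the cobang, `μ[X]` the codiagonal), coherent with the monoidal
structure and natural. -/
class FiniteCoproductCategory where
  [monObj : (X : C) → MonObj X]
  [isCommMonObj : (X : C) → IsCommMonObj X]
  codiag_tensor (X Y : C) : μ[X ⊗ Y] = tensorμ X Y X Y ≫ (μ[X] ⊗ₘ μ[Y])
  cobang_tensor (X Y : C) : η[X ⊗ Y] = (λ_ (𝟙_ C)).inv ≫ (η[X] ⊗ₘ η[Y])
  codiag_unit : μ[𝟙_ C] = (λ_ (𝟙_ C)).hom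
  cobang_unit : η[𝟙_ C] = 𝟙 (𝟙_ C)
  codiag_naturality {X Y : C} (f : X ⟶ Y) : μ[X] ≫ f = (f ⊗ₘ f) ≫ μ[Y]
  cobang_naturality {X Y : C} (f : X ⟶ Y) : η[X] ≫ f = η[Y]

attribute [reducible] FiniteCoproductCategory.monObj
attribute [instance] FiniteCoproductCategory.monObj FiniteCoproductCategory.isCommMonObj

end FC

section OpCartesian
open CartesianMonoidalCategory
variable {D : Type u₁} [Category.{v₁} D] [CartesianMonoidalCategory D]

theorem diag_left (X : D) : lift (𝟙 X) (𝟙 X) ≫ toUnit X ▷ X = (λ_ X).inv := by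
  ext; simp

theorem diag_right (X : D) : lift (𝟙 X) (𝟙 X) ≫ X ◁ toUnit X = (ρ_ X).inv := by
  ext; simp

theorem diag_tensor [BraidedCategory D] (X Y : D) :
    lift (𝟙 (X ⊗ Y)) (𝟙 (X ⊗ Y)) = (lift (𝟙 X) (𝟙 X) ⊗ₘ lift (𝟙 Y) (𝟙 Y)) ≫ tensorμ X X Y Y := by
  ext <;> simp [tensorμ]

theorem diag_unit : lift (𝟙 (𝟙_ D)) (𝟙 (𝟙_ D)) = (λ_ (𝟙_ D)).inv := by
  ext

/-- The monoid on an object of the opposite of a category with finite products given by the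
diagonal and the map to the terminal object. -/
abbrev opMonObj (X : Dᵒᵖ) : MonObj X where
  one := (toUnit X.unop).op
  mul := (lift (𝟙 X.unop) (𝟙 X.unop)).op
  one_mul := Quiver.Hom.unop_inj (diag_left X.unop)
  mul_one := Quiver.Hom.unop_inj (diag_right X.unop)
  mul_assoc := Quiver.Hom.unop_inj (by simp)

attribute [local instance] opMonObj

variable [BraidedCategory D]

instance : SymmetricCategory Dᵒᵖ where
  symmetry X Y := Quiver.Hom.unop_inj (by simp)

/-- The opposite of a category with finite products is a finite coproduct category. -/
instance : FiniteCoproductCategory Dᵒᵖ where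
  monObj X := opMonObj X
  isCommMonObj X := { mul_comm := Quiver.Hom.unop_inj (by simp [MonObj.mul]) }
  codiag_tensor X Y := Quiver.Hom.unop_inj (by
    rw [unop_comp, BraidedCategory.unop_tensorμ]
    exact diag_tensor X.unop Y.unop)
  cobang_tensor X Y := Quiver.Hom.unop_inj (toUnit_unique _ _)
  codiag_unit := Quiver.Hom.unop_inj diag_unit
  cobang_unit := Quiver.Hom.unop_inj (toUnit_unique _ _)
  codiag_naturality f := Quiver.Hom.unop_inj (by simp [MonObj.mul])
  cobang_naturality f := Quiver.Hom.unop_inj (toUnit_unique _ _)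

end OpCartesian
section Copower

variable {C : Type u₁} [Category.{v₁} C] [MonoidalCategory C] [SymmetricCategory C]
  [FiniteCoproductCategory C]

open scoped MonObj

/-- The injections of a finite coproduct category. -/
def inl (X Y : C) : X ⟶ X ⊗ Y := (ρ_ X).inv ≫ X ◁ η[Y]
def inr (X Y : C) : Y ⟶ X ⊗ Y := (λ_ Y).inv ≫ η[X] ▷ Y

/-- The copairing of a finite coproduct category. -/
def copair {X Y Z : C} (f : X ⟶ Z) (g : Y ⟶ Z) : X ⊗ Y ⟶ Z := (f ⊗ₘ g) ≫ μ[Z]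

theorem inl_copair {X Y Z : C} (f : X ⟶ Z) (g : Y ⟶ Z) : inl X Y ≫ copair f g = f := by
  have h : X ◁ η[Y] ≫ (f ⊗ₘ g) = f ▷ _ ≫ Z ◁ η[Z] := by
    rw [← FiniteCoproductCategory.cobang_naturality g, MonoidalCategory.tensorHom_def,
      MonoidalCategory.whiskerLeft_comp, MonoidalCategory.whisker_exchange_assoc]
  simp [inl, copair, reassoc_of% h]

theorem inr_copair {X Y Z : C} (f : X ⟶ Z) (g : Y ⟶ Z) : inr X Y ≫ copair f g = g := by
  have h : η[X] ▷ Y ≫ (f ⊗ₘ g) = _ ◁ g ≫ η[Z] ▷ Z := by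
    rw [← FiniteCoproductCategory.cobang_naturality f]
    rw [MonoidalCategory.tensorHom_def', MonoidalCategory.comp_whiskerRight, MonoidalCategory.whisker_exchange_assoc]
  simp [inr, copair, reassoc_of% h]

theorem copair_comp {X Y Z W : C} (f : X ⟶ Z) (g : Y ⟶ Z) (h : Z ⟶ W) :
    copair f g ≫ h = copair (f ≫ h) (g ≫ h) := by
  simp [copair, FiniteCoproductCategory.codiag_naturality]

theorem copair_inl_inr (X Y : C) : copair (inl X Y) (inr X Y) = 𝟙 (X ⊗ Y) := by
  have h := tensorμ_natural (𝟙 X) η[Y] η[X] (𝟙 Y)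
  simp only [id_tensorHom, tensorHom_id] at h
  have h2 : ((ρ_ X).inv ⊗ₘ (λ_ Y).inv) ≫ tensorμ X (𝟙_ C) (𝟙_ C) Y ≫ ((ρ_ X).hom ⊗ₘ (λ_ Y).hom)
      = 𝟙 (X ⊗ Y) := by
    simp only [tensorμ, braiding_tensorUnit_left]
    monoidal
  rw [copair, inl, inr, FiniteCoproductCategory.codiag_tensor, ← tensorHom_comp_tensorHom,
    Category.assoc, reassoc_of% h]
  simp only [tensorHom_comp_tensorHom, MonObj.mul_one, MonObj.one_mul]
  exact h2

/-- The `n`-fold sum of `A`: `A ⊗ (A ⊗ (… ⊗ A))`, where the `0`-fold sum is the unit and the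
`1`-fold sum is `A`. -/
def nsum (A : C) : ℕ → C
  | 0 => 𝟙_ C
  | 1 => A
  | n + 2 => A ⊗ nsum A (n + 1)

/-- The injections of the `n`-fold sum. -/
def nsumInj (A : C) : (n : ℕ) → Fin n → (A ⟶ nsum A n)
  | 0 => fun k => k.elim0
  | 1 => fun _ => 𝟙 A
  | n + 2 => Fin.cases (inl A (nsum A (n + 1)))
      fun k => nsumInj A (n + 1) k ≫ inr A (nsum A (n + 1))

/-- The cotupling out of the `n`-fold sum. -/
def nsumDesc {A Y : C} : (n : ℕ) → (Fin n → (A ⟶ Y)) → (nsum A n ⟶ Y)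
  | 0 => fun _ => η[Y]
  | 1 => fun g => g 0
  | n + 2 => fun g => copair (g 0) (nsumDesc (n + 1) fun k => g k.succ)

theorem nsumInj_desc {A Y : C} : (n : ℕ) → (g : Fin n → (A ⟶ Y)) → (k : Fin n) →
    nsumInj A n k ≫ nsumDesc n g = g k
  | 0 => fun _ k => k.elim0
  | 1 => fun g k => by
    rw [Subsingleton.elim k 0]
    exact Category.id_comp _
  | n + 2 => fun g k => by
    refine Fin.cases ?_ (fun k => ?_) k
    · exact inl_copair _ _
    · change (nsumInj A (n + 1) k ≫ inr A (nsum A (n + 1))) ≫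
        copair (g 0) (nsumDesc (n + 1) fun k => g k.succ) = g k.succ
      rw [Category.assoc, inr_copair]
      exact nsumInj_desc (n + 1) _ k

theorem nsumDesc_comp {A Y Z : C} (h : Y ⟶ Z) : (n : ℕ) → (g : Fin n → (A ⟶ Y)) →
    nsumDesc n g ≫ h = nsumDesc n fun k => g k ≫ h
  | 0 => fun _ => FiniteCoproductCategory.cobang_naturality h
  | 1 => fun _ => rfl
  | n + 2 => fun g => (copair_comp _ _ h).trans
    (congrArg (copair (g 0 ≫ h)) (nsumDesc_comp h (n + 1) fun k => g k.succ))

theorem nsumDesc_inj (A : C) : (n : ℕ) → nsumDesc n (nsumInj A n) = 𝟙 (nsum A n)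
  | 0 => FiniteCoproductCategory.cobang_unit
  | 1 => rfl
  | n + 2 => by
    change copair (inl A (nsum A (n + 1))) (nsumDesc (n + 1) fun k =>
      nsumInj A (n + 1) k ≫ inr A (nsum A (n + 1))) = 𝟙 (A ⊗ nsum A (n + 1))
    rw [← nsumDesc_comp, nsumDesc_inj A (n + 1), Category.id_comp, copair_inl_inr]

/-- The canonical functor from finite ordinals which sends `n` to the `n`-fold sum of `A`, and a
function `f` to the cotuple of the injections chosen by `f`. -/
def copower (A : C) : Aleph0 ⥤ C where
  obj n := nsum A n.len
  map {n m} f := nsumDesc n.len fun k => nsumInj A m.len (f k)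
  map_id n := nsumDesc_inj A n.len
  map_comp {n m l} f g := by
    simp only [nsumDesc_comp, nsumInj_desc]
    rfl

end Copower

section FCFunctor

open scoped MonObj

variable (C : Type u₁) [Category.{v₁} C] [MonoidalCategory C] [SymmetricCategory C]
  [FiniteCoproductCategory C] (D : Type u₂) [Category.{v₂} D] [MonoidalCategory D]
  [SymmetricCategory D] [FiniteCoproductCategory D]

/-- A morphism of finite coproduct categories: a strong symmetric monoidal functor which preserves
the monoids. -/
structure FCFunctor extends C ⥤ D where
  [braided : toFunctor.Braided]
  map_codiag (X : C) : Functor.LaxMonoidal.μ toFunctor X X ≫ map μ[X] = μ[obj X]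
  map_cobang (X : C) : Functor.LaxMonoidal.ε toFunctor ≫ map η[X] = η[obj X]

end FCFunctor

section Kleisli

variable {C : Type u₁} [Category.{v₁} C] {T : Monad C}

theorem comp_pure_of {X : Kleisli T} {Y Z : C} (f : X ⟶ Kleisli.mk T Y) (g : Y ⟶ Z) :
    (f ≫ (Kleisli.Adjunction.toKleisli T).map g).of = f.of ≫ T.map g := by
  change f.of ≫ T.map (g ≫ T.η.app Z) ≫ T.μ.app Z = _
  simp

theorem pure_comp_of {X Y : C} {Z : Kleisli T} (f : X ⟶ Y) (g : Kleisli.mk T Y ⟶ Z) :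
    ((Kleisli.Adjunction.toKleisli T).map f ≫ g).of = f ≫ g.of := by
  change (f ≫ T.η.app Y) ≫ T.map g.of ≫ T.μ.app Z.of = _
  rw [Category.assoc, ← T.η.naturality_assoc, T.left_unit]
  exact congrArg (f ≫ ·) (Category.comp_id g.of)

end Kleisli

section MonoidalMonad

variable {C : Type u₁} [Category.{v₁} C] [MonoidalCategory C] [SymmetricCategory C]

/-- The structure of a symmetric monoidal monad on a monad `T` over a symmetric monoidal
category. -/
class SymmetricMonoidalMonad (T : Monad C) where
  m (X Y : C) : T.obj X ⊗ T.obj Y ⟶ T.obj (X ⊗ Y)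
  naturality {X X' Y Y' : C} (f : X ⟶ X') (g : Y ⟶ Y') :
    (T.map f ⊗ₘ T.map g) ≫ m X' Y' = m X Y ≫ T.map (f ⊗ₘ g)
  symm (X Y : C) : m X Y ≫ T.map (β_ X Y).hom = (β_ (T.obj X) (T.obj Y)).hom ≫ m Y X
  unit (X Y : C) : (T.η.app X ⊗ₘ T.η.app Y) ≫ m X Y = T.η.app (X ⊗ Y)
  mul (X Y : C) : (T.μ.app X ⊗ₘ T.μ.app Y) ≫ m X Y =
    m (T.obj X) (T.obj Y) ≫ T.map (m X Y) ≫ T.μ.app (X ⊗ Y)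
  assoc (X Y Z : C) : m X Y ▷ T.obj Z ≫ m (X ⊗ Y) Z ≫ T.map (α_ X Y Z).hom =
    (α_ (T.obj X) (T.obj Y) (T.obj Z)).hom ≫ T.obj X ◁ m Y Z ≫ m X (Y ⊗ Z)
  left_unit (X : C) : T.η.app (𝟙_ C) ▷ T.obj X ≫ m (𝟙_ C) X ≫ T.map (λ_ X).hom =
    (λ_ (T.obj X)).hom
  right_unit (X : C) : T.obj X ◁ T.η.app (𝟙_ C) ≫ m X (𝟙_ C) ≫ T.map (ρ_ X).hom =
    (ρ_ (T.obj X)).hom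

namespace SymmetricMonoidalMonad

variable {T : Monad C} (M : SymmetricMonoidalMonad T)

theorem tensor_pure {X X' Y Y' : C} (f : X ⟶ X') (g : Y ⟶ Y') :
    ((f ≫ T.η.app X') ⊗ₘ (g ≫ T.η.app Y')) ≫ M.m X' Y' = (f ⊗ₘ g) ≫ T.η.app (X' ⊗ Y') := by
  rw [← tensorHom_comp_tensorHom, Category.assoc, M.unit]

/-- The monoidal structure on the Kleisli category of a symmetric monoidal monad: it is the one of
the base category on objects, `f ⊗ g` is `(f ⊗ g) ≫ m`, and the structural isomorphisms are the
images of those of the base category. -/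
@[reducible]
def kleisliStruct : MonoidalCategoryStruct (Kleisli T) where
  tensorObj X Y := .mk T (X.of ⊗ Y.of)
  tensorHom {_ X' _ Y'} f g := .mk ((f.of ⊗ₘ g.of) ≫ M.m X'.of Y'.of)
  whiskerLeft X {_ Y'} g := .mk ((T.η.app X.of ⊗ₘ g.of) ≫ M.m X.of Y'.of)
  whiskerRight {_ X'} f Y := .mk ((f.of ⊗ₘ T.η.app Y.of) ≫ M.m X'.of Y.of)
  tensorUnit := .mk T (𝟙_ C)
  associator X Y Z := (Kleisli.Adjunction.toKleisli T).mapIso (α_ X.of Y.of Z.of)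
  leftUnitor X := (Kleisli.Adjunction.toKleisli T).mapIso (λ_ X.of)
  rightUnitor X := (Kleisli.Adjunction.toKleisli T).mapIso (ρ_ X.of)

theorem kleisli_tensor_map {X X' Y Y' : C} (f : X ⟶ X') (g : Y ⟶ Y') :
    M.kleisliStruct.tensorHom ((Kleisli.Adjunction.toKleisli T).map f)
      ((Kleisli.Adjunction.toKleisli T).map g) = (Kleisli.Adjunction.toKleisli T).map (f ⊗ₘ g) :=
  Kleisli.hom_ext (M.tensor_pure f g)

@[reducible]
def kleisliMonoidal : MonoidalCategory (Kleisli T) :=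
  letI := M.kleisliStruct
  MonoidalCategory.ofTensorHom
    (id_tensorHom_id := fun X Y => Kleisli.hom_ext (M.unit X.of Y.of))
    (tensorHom_comp_tensorHom := fun {X₁ Y₁ Z₁ X₂ Y₂ Z₂} f₁ f₂ g₁ g₂ => Kleisli.hom_ext (by
      change ((f₁.of ⊗ₘ f₂.of) ≫ M.m _ _) ≫ T.map ((g₁.of ⊗ₘ g₂.of) ≫ M.m _ _) ≫ T.μ.app _ =
        ((f₁.of ≫ T.map g₁.of ≫ T.μ.app _) ⊗ₘ (f₂.of ≫ T.map g₂.of ≫ T.μ.app _)) ≫ M.m _ _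
      simp only [← tensorHom_comp_tensorHom, Category.assoc, M.mul, T.map_comp]
      rw [reassoc_of% (M.naturality g₁.of g₂.of)]))
    (associator_naturality := fun {X₁ X₂ X₃ Y₁ Y₂ Y₃} f₁ f₂ f₃ => Kleisli.hom_ext (by
      refine (comp_pure_of _ _).trans (Eq.trans ?_ (pure_comp_of _ _).symm)
      change ((((f₁.of ⊗ₘ f₂.of) ≫ M.m _ _) ⊗ₘ f₃.of) ≫ M.m _ _) ≫ T.map (α_ _ _ _).hom =
        (α_ _ _ _).hom ≫ (f₁.of ⊗ₘ ((f₂.of ⊗ₘ f₃.of) ≫ M.m _ _)) ≫ M.m _ _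
      have h := M.assoc Y₁.of Y₂.of Y₃.of
      rw [← tensorHom_id, ← id_tensorHom] at h
      have e₁ : ((f₁.of ⊗ₘ f₂.of) ≫ M.m Y₁.of Y₂.of) ⊗ₘ f₃.of =
        ((f₁.of ⊗ₘ f₂.of) ⊗ₘ f₃.of) ≫ (M.m _ _ ⊗ₘ 𝟙 _) := by
        rw [tensorHom_comp_tensorHom, Category.comp_id]
      have e₂ : f₁.of ⊗ₘ ((f₂.of ⊗ₘ f₃.of) ≫ M.m Y₂.of Y₃.of) =
        (f₁.of ⊗ₘ (f₂.of ⊗ₘ f₃.of)) ≫ (𝟙 _ ⊗ₘ M.m _ _) := by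
        rw [tensorHom_comp_tensorHom, Category.comp_id]
      rw [e₁, e₂, Category.assoc, Category.assoc, h, Category.assoc,
        associator_naturality_assoc]))
    (leftUnitor_naturality := fun {X Y} f => Kleisli.hom_ext (by
      refine (comp_pure_of _ _).trans (Eq.trans ?_ (pure_comp_of _ _).symm)
      change ((T.η.app _ ⊗ₘ f.of) ≫ M.m _ _) ≫ T.map (λ_ _).hom = (λ_ _).hom ≫ f.of
      rw [← leftUnitor_naturality, ← M.left_unit, MonoidalCategory.tensorHom_def']
      simp))
    (rightUnitor_naturality := fun {X Y} f => Kleisli.hom_ext (by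
      refine (comp_pure_of _ _).trans (Eq.trans ?_ (pure_comp_of _ _).symm)
      change ((f.of ⊗ₘ T.η.app _) ≫ M.m _ _) ≫ T.map (ρ_ _).hom = (ρ_ _).hom ≫ f.of
      rw [← rightUnitor_naturality, ← M.right_unit, MonoidalCategory.tensorHom_def]
      simp))
    (pentagon := fun X Y Z W => by
      have h := congrArg (Kleisli.Adjunction.toKleisli T).map
        (MonoidalCategory.pentagon X.of Y.of Z.of W.of)
      rw [← tensorHom_id, ← id_tensorHom, Functor.map_comp, Functor.map_comp, Functor.map_comp,
        ← M.kleisli_tensor_map, ← M.kleisli_tensor_map, CategoryTheory.Functor.map_id,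
        CategoryTheory.Functor.map_id] at h
      exact h)
    (triangle := fun X Y => by
      have h := congrArg (Kleisli.Adjunction.toKleisli T).map
        (MonoidalCategory.triangle X.of Y.of)
      rw [← tensorHom_id, ← id_tensorHom, Functor.map_comp,
        ← M.kleisli_tensor_map, ← M.kleisli_tensor_map, CategoryTheory.Functor.map_id,
        CategoryTheory.Functor.map_id] at h
      exact h)

instance [M : SymmetricMonoidalMonad T] : MonoidalCategory (Kleisli T) := M.kleisliMonoidal

end SymmetricMonoidalMonad
end MonoidalMonad

section Sum

/-- A second symmetric monoidal structure `(⊕, 0)` on a category, kept apart from the class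
`MonoidalCategory`, which is used for `(⊗, 1)`. -/
class SymmetricSum (C : Type u₁) [Category.{v₁} C] where
  monoidal : MonoidalCategory C
  symmetric : @SymmetricCategory C _ monoidal

variable {C : Type u₁} [Category.{v₁} C] [S : SymmetricSum C]

abbrev sumObj (X Y : C) : C := S.monoidal.tensorObj X Y
infixr:65 " ⊕ₒ " => sumObj

abbrev sumHom {X X' Y Y' : C} (f : X ⟶ X') (g : Y ⟶ Y') : (X ⊕ₒ Y) ⟶ (X' ⊕ₒ Y') :=
  S.monoidal.tensorHom f g
infixr:75 " ⊕ₘ " => sumHom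

variable (C) in
abbrev sumZero : C := S.monoidal.tensorUnit

abbrev sumAssoc (X Y Z : C) : ((X ⊕ₒ Y) ⊕ₒ Z) ≅ (X ⊕ₒ (Y ⊕ₒ Z)) := S.monoidal.associator X Y Z
abbrev sumLeft (X : C) : (sumZero C ⊕ₒ X) ≅ X := S.monoidal.leftUnitor X
abbrev sumRight (X : C) : (X ⊕ₒ sumZero C) ≅ X := S.monoidal.rightUnitor X
abbrev sumBraid (X Y : C) : (X ⊕ₒ Y) ≅ (Y ⊕ₒ X) := S.symmetric.braiding X Y

/-- The middle-four interchange `(X₁ ⊕ X₂) ⊕ (Y₁ ⊕ Y₂) ⟶ (X₁ ⊕ Y₁) ⊕ (X₂ ⊕ Y₂)`. -/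
abbrev sumMid (X₁ X₂ Y₁ Y₂ : C) :
    ((X₁ ⊕ₒ X₂) ⊕ₒ (Y₁ ⊕ₒ Y₂)) ⟶ ((X₁ ⊕ₒ Y₁) ⊕ₒ (X₂ ⊕ₒ Y₂)) :=
  @tensorμ C _ S.monoidal S.symmetric.toBraidedCategory X₁ X₂ Y₁ Y₂

/-- The structure `(⊕, 0)` is a finite coproduct category. -/
abbrev SumIsFC (C : Type u₁) [Category.{v₁} C] [S : SymmetricSum C] :=
  @FiniteCoproductCategory C _ S.monoidal S.symmetric

variable [F : SumIsFC C]

abbrev sumCodiag (X : C) : (X ⊕ₒ X) ⟶ X :=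
  (@FiniteCoproductCategory.monObj C _ S.monoidal S.symmetric F X).mul
abbrev sumCobang (X : C) : sumZero C ⟶ X :=
  (@FiniteCoproductCategory.monObj C _ S.monoidal S.symmetric F X).one

/-- The `n`-fold sum of `A` with respect to `⊕`. -/
abbrev sumN (A : C) (n : ℕ) : C := @nsum C _ S.monoidal A n
abbrev sumInj (A : C) (n : ℕ) (k : Fin n) : A ⟶ sumN A n :=
  @nsumInj C _ S.monoidal S.symmetric F A n k
/-- The canonical functor from finite ordinals which sends `n` to the `n`-fold sum of `A` with
respect to `⊕`. -/
abbrev sumCopower (A : C) : Aleph0 ⥤ C := @copower C _ S.monoidal S.symmetric F A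

/-- Morphisms of finite coproduct categories to `C` with the structure `(⊕, 0)`. -/
abbrev SumFCFunctor (B : Type u₂) [Category.{v₂} B] [MonoidalCategory B] [SymmetricCategory B]
    [FiniteCoproductCategory B] (C : Type u₁) [Category.{v₁} C] [S : SymmetricSum C]
    [F : SumIsFC C] :=
  @FCFunctor B _ _ _ _ C _ S.monoidal S.symmetric F

abbrev SumFCFunctor.functor {B : Type u₂} [Category.{v₂} B] [MonoidalCategory B]
    [SymmetricCategory B] [FiniteCoproductCategory B] (i : SumFCFunctor B C) : B ⥤ C :=
  @FCFunctor.toFunctor B _ _ _ _ C _ S.monoidal S.symmetric F i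

end Sum

section Rig

open scoped ComonObj

/-- A (symmetric) rig category: symmetric monoidal structures `(⊗, 1)` and `(⊕, 0)`, with natural
distributors and annihilators satisfying Laplaza's coherence axioms. -/
class RigCategory (C : Type u₁) [Category.{v₁} C] [MonoidalCategory C] [SymmetricCategory C]
    [SymmetricSum C] where
  dl (X Y Z : C) : X ⊗ (Y ⊕ₒ Z) ≅ (X ⊗ Y) ⊕ₒ (X ⊗ Z)
  dr (X Y Z : C) : (X ⊕ₒ Y) ⊗ Z ≅ (X ⊗ Z) ⊕ₒ (Y ⊗ Z)
  annl (X : C) : sumZero C ⊗ X ≅ sumZero C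
  annr (X : C) : X ⊗ sumZero C ≅ sumZero C
  dl_naturality {X X' Y Y' Z Z' : C} (f : X ⟶ X') (g : Y ⟶ Y') (h : Z ⟶ Z') :
    (f ⊗ₘ (g ⊕ₘ h)) ≫ (dl X' Y' Z').hom = (dl X Y Z).hom ≫ ((f ⊗ₘ g) ⊕ₘ (f ⊗ₘ h))
  dr_naturality {X X' Y Y' Z Z' : C} (f : X ⟶ X') (g : Y ⟶ Y') (h : Z ⟶ Z') :
    ((f ⊕ₘ g) ⊗ₘ h) ≫ (dr X' Y' Z').hom = (dr X Y Z).hom ≫ ((f ⊗ₘ h) ⊕ₘ (g ⊗ₘ h))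
  annl_naturality {X X' : C} (f : X ⟶ X') : (sumZero C ◁ f) ≫ (annl X').hom = (annl X).hom
  annr_naturality {X X' : C} (f : X ⟶ X') : (f ▷ sumZero C) ≫ (annr X').hom = (annr X).hom
  dl_sumBraid (X Y Z : C) :
    (dl X Y Z).hom ≫ (sumBraid (X ⊗ Y) (X ⊗ Z)).hom = X ◁ (sumBraid Y Z).hom ≫ (dl X Z Y).hom
  dr_sumBraid (X Y Z : C) :
    (dr X Y Z).hom ≫ (sumBraid (X ⊗ Z) (Y ⊗ Z)).hom = (sumBraid X Y).hom ▷ Z ≫ (dr Y X Z).hom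
  braid_dl (X Y Z : C) :
    (β_ (X ⊕ₒ Y) Z).hom ≫ (dl Z X Y).hom = (dr X Y Z).hom ≫ ((β_ X Z).hom ⊕ₘ (β_ Y Z).hom)
  dl_sumAssoc (X Y Z W : C) :
    (dl X (Y ⊕ₒ Z) W).hom ≫ ((dl X Y Z).hom ⊕ₘ 𝟙 (X ⊗ W)) ≫
        (sumAssoc (X ⊗ Y) (X ⊗ Z) (X ⊗ W)).hom =
      X ◁ (sumAssoc Y Z W).hom ≫ (dl X Y (Z ⊕ₒ W)).hom ≫ (𝟙 (X ⊗ Y) ⊕ₘ (dl X Z W).hom)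
  dr_sumAssoc (X Y Z W : C) :
    (dr (X ⊕ₒ Y) Z W).hom ≫ ((dr X Y W).hom ⊕ₘ 𝟙 (Z ⊗ W)) ≫
        (sumAssoc (X ⊗ W) (Y ⊗ W) (Z ⊗ W)).hom =
      (sumAssoc X Y Z).hom ▷ W ≫ (dr X (Y ⊕ₒ Z) W).hom ≫ (𝟙 (X ⊗ W) ⊕ₘ (dr Y Z W).hom)
  dl_assoc (X Y Z W : C) :
    (dl (X ⊗ Y) Z W).hom ≫ ((α_ X Y Z).hom ⊕ₘ (α_ X Y W).hom) =
      (α_ X Y (Z ⊕ₒ W)).hom ≫ X ◁ (dl Y Z W).hom ≫ (dl X (Y ⊗ Z) (Y ⊗ W)).hom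
  dr_assoc (X Y Z W : C) :
    (dr X Y Z).hom ▷ W ≫ (dr (X ⊗ Z) (Y ⊗ Z) W).hom ≫ ((α_ X Z W).hom ⊕ₘ (α_ Y Z W).hom) =
      (α_ (X ⊕ₒ Y) Z W).hom ≫ (dr X Y (Z ⊗ W)).hom
  dl_dr_assoc (X Y Z W : C) :
    (dl X Y Z).hom ▷ W ≫ (dr (X ⊗ Y) (X ⊗ Z) W).hom ≫ ((α_ X Y W).hom ⊕ₘ (α_ X Z W).hom) =
      (α_ X (Y ⊕ₒ Z) W).hom ≫ X ◁ (dr Y Z W).hom ≫ (dl X (Y ⊗ W) (Z ⊗ W)).hom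
  dr_dl (X Y Z W : C) :
    (dr X Y (Z ⊕ₒ W)).hom ≫ ((dl X Z W).hom ⊕ₘ (dl Y Z W).hom) ≫
        sumMid (X ⊗ Z) (X ⊗ W) (Y ⊗ Z) (Y ⊗ W) =
      (dl (X ⊕ₒ Y) Z W).hom ≫ ((dr X Y Z).hom ⊕ₘ (dr X Y W).hom)
  annl_zero : (annl (sumZero C)).hom = (annr (sumZero C)).hom
  annl_sum (X Y : C) :
    (annl (X ⊕ₒ Y)).hom =
      (dl (sumZero C) X Y).hom ≫ ((annl X).hom ⊕ₘ (annl Y).hom) ≫ (sumLeft (sumZero C)).hom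
  annr_sum (X Y : C) :
    (annr (X ⊕ₒ Y)).hom =
      (dr X Y (sumZero C)).hom ≫ ((annr X).hom ⊕ₘ (annr Y).hom) ≫ (sumLeft (sumZero C)).hom
  annl_one : (annl (𝟙_ C)).hom = (ρ_ (sumZero C)).hom
  annr_one : (annr (𝟙_ C)).hom = (λ_ (sumZero C)).hom
  annr_braid (X : C) : (annr X).hom = (β_ X (sumZero C)).hom ≫ (annl X).hom
  annl_tensor (X Y : C) :
    (α_ (sumZero C) X Y).hom ≫ (annl (X ⊗ Y)).hom = (annl X).hom ▷ Y ≫ (annl Y).hom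
  annr_annl_tensor (X Y : C) :
    (α_ X (sumZero C) Y).hom ≫ X ◁ (annl Y).hom ≫ (annr X).hom = (annr X).hom ▷ Y ≫ (annl Y).hom
  annr_tensor (X Y : C) :
    (α_ X Y (sumZero C)).hom ≫ X ◁ (annr Y).hom ≫ (annr X).hom = (annr (X ⊗ Y)).hom
  dl_sumLeft (X Y : C) :
    (dl X (sumZero C) Y).hom ≫ ((annr X).hom ⊕ₘ 𝟙 (X ⊗ Y)) ≫ (sumLeft (X ⊗ Y)).hom =
      X ◁ (sumLeft Y).hom
  dr_sumLeft (X Y : C) :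
    (dr (sumZero C) X Y).hom ≫ ((annl Y).hom ⊕ₘ 𝟙 (X ⊗ Y)) ≫ (sumLeft (X ⊗ Y)).hom =
      (sumLeft X).hom ▷ Y
  dl_sumRight (X Y : C) :
    (dl X Y (sumZero C)).hom ≫ (𝟙 (X ⊗ Y) ⊕ₘ (annr X).hom) ≫ (sumRight (X ⊗ Y)).hom =
      X ◁ (sumRight Y).hom
  dr_sumRight (X Y : C) :
    (dr X (sumZero C) Y).hom ≫ (𝟙 (X ⊗ Y) ⊕ₘ (annl Y).hom) ≫ (sumRight (X ⊗ Y)).hom =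
      (sumRight X).hom ▷ Y
  dl_one (X Y : C) :
    (dl (𝟙_ C) X Y).hom ≫ ((λ_ X).hom ⊕ₘ (λ_ Y).hom) = (λ_ (X ⊕ₒ Y)).hom
  dr_one (X Y : C) :
    (dr X Y (𝟙_ C)).hom ≫ ((ρ_ X).hom ⊕ₘ (ρ_ Y).hom) = (ρ_ (X ⊕ₒ Y)).hom

/-- A finite coproduct-copy discard rig category: a rig category such that `(⊕, 0)` is a finite
coproduct category, `(⊗, 1)` is a copy-discard category, and the comonoid of a sum is determined by
the comonoids of its summands. -/
class FCCDRigCategory (C : Type u₁) [Category.{v₁} C] [MonoidalCategory C] [SymmetricSum C] where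
  [cd : CopyDiscardCategory C]
  [fc : SumIsFC C]
  [rig : RigCategory C]
  discard_sum (X Y : C) : ε[X ⊕ₒ Y] = (ε[X] ⊕ₘ ε[Y]) ≫ sumCodiag (𝟙_ C)
  copy_sum (X Y : C) : Δ[X ⊕ₒ Y] =
    ((sumRight X).inv ⊕ₘ (sumLeft Y).inv) ≫
      ((Δ[X] ⊕ₘ sumCobang (X ⊗ Y)) ⊕ₘ (sumCobang (Y ⊗ X) ⊕ₘ Δ[Y])) ≫
        ((rig.dl X X Y).inv ⊕ₘ (rig.dl Y X Y).inv) ≫ (rig.dr X Y (X ⊕ₒ Y)).inv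

attribute [reducible] FCCDRigCategory.cd FCCDRigCategory.fc FCCDRigCategory.rig

/-- The structure which makes a finite coproduct rig category into a `T`-rig category: a morphism
of finite coproduct categories from the opposite of the Lawvere theory, which restricts along
`ordToLawvere T` to the canonical functor sending the ordinal `n` to `1 ⊕ (1 ⊕ (… ⊕ 1))`. -/
structure TRigStructure (T : AlgebraicTheory.{u}) (C : Type u₁) [Category.{v₁} C]
    [MonoidalCategory C] [SymmetricSum C] [SumIsFC C] where
  i : SumFCFunctor (Lawvere T)ᵒᵖ C
  comm : ordToLawvere T ⋙ SumFCFunctor.functor i = sumCopower (𝟙_ C)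

theorem TRigStructure.obj_eq {T : AlgebraicTheory.{u}} {C : Type u₁} [Category.{v₁} C]
    [MonoidalCategory C] [SymmetricSum C] [SumIsFC C] (R : TRigStructure T C) (n : ℕ) :
    (SumFCFunctor.functor R.i).obj (.op ⟨n⟩) = sumN (𝟙_ C) n :=
  Functor.congr_obj R.comm ⟨n⟩

/-- A `T`-copy discard rig category: a finite coproduct-copy discard rig category which is a
`T`-rig category. -/
structure TCDRigCategory (T : AlgebraicTheory.{u}) (C : Type u₁) [Category.{v₁} C]
    [MonoidalCategory C] [SymmetricSum C] where
  fccd : FCCDRigCategory C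
  tRig : letI := fccd.fc; TRigStructure T C

end Rig

section KleisliType

variable (M : Monad (Type u))

/-- The arrow of the Kleisli category given by a function. -/
def pureHom {X Y : Kleisli M} (f : X.of → Y.of) : X ⟶ Y := .mk (↾f ≫ M.η.app Y.of)

/-- The isomorphism of the Kleisli category given by a bijection. -/
def pureIso {X Y : Kleisli M} (e : X.of ≃ Y.of) : X ≅ Y :=
  (Kleisli.Adjunction.toKleisli M).mapIso e.toIso

variable {M}

theorem pureHom_comp {X Y Z : Kleisli M} (f : X.of → Y.of) (g : Y.of → Z.of) :
    pureHom M f ≫ pureHom M g = pureHom M (fun x => g (f x)) :=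
  ((Kleisli.Adjunction.toKleisli M).map_comp (↾f) (↾g)).symm

theorem pureHom_comp_apply {X Y Z : Kleisli M} (f : X.of → Y.of) (g : Y ⟶ Z) (x : X.of) :
    (pureHom M f ≫ g).of x = g.of (f x) :=
  ConcreteCategory.congr_hom (pure_comp_of (↾f) g) x

theorem comp_pureHom_apply {X Y Z : Kleisli M} (f : X ⟶ Y) (g : Y.of → Z.of) (x : X.of) :
    (f ≫ pureHom M g).of x = M.map (↾g) (f.of x) :=
  ConcreteCategory.congr_hom (comp_pure_of f (↾g)) x

theorem pureHom_id (X : Kleisli M) : pureHom M (fun x : X.of => x) = 𝟙 X :=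
  (Kleisli.Adjunction.toKleisli M).map_id X.of

/-- The disjoint union of sets, as an operation on the Kleisli category. -/
def ksum (X Y : Kleisli M) : Kleisli M := .mk M (X.of ⊕ Y.of)

/-- The injections into the disjoint union. -/
def kinl (X Y : Kleisli M) : X ⟶ ksum X Y := pureHom M Sum.inl
def kinr (X Y : Kleisli M) : Y ⟶ ksum X Y := pureHom M Sum.inr

/-- The action of the disjoint union on arrows: the copairing of `f ≫ M inl` and `g ≫ M inr`. -/
def kmap {X X' Y Y' : Kleisli M} (f : X ⟶ X') (g : Y ⟶ Y') : ksum X Y ⟶ ksum X' Y' :=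
  .mk (↾Sum.elim (fun x => M.map (↾Sum.inl) (f.of x)) (fun y => M.map (↾Sum.inr) (g.of y)))

theorem ksum_ext {X Y Z : Kleisli M} {f g : ksum X Y ⟶ Z}
    (h₁ : kinl X Y ≫ f = kinl X Y ≫ g) (h₂ : kinr X Y ≫ f = kinr X Y ≫ g) : f = g := by
  apply Kleisli.hom_ext
  ext z
  cases z with
  | inl x =>
    exact (pureHom_comp_apply _ f x).symm.trans
      ((congrArg (fun k : X ⟶ Z => k.of x) h₁).trans (pureHom_comp_apply _ g x))
  | inr y =>
    exact (pureHom_comp_apply _ f y).symm.trans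
      ((congrArg (fun k : Y ⟶ Z => k.of y) h₂).trans (pureHom_comp_apply _ g y))

theorem kempty_ext {Z : Kleisli M} (f g : Kleisli.mk M PEmpty.{u + 1} ⟶ Z) : f = g := by
  apply Kleisli.hom_ext
  ext z
  exact z.elim

theorem kinl_kmap {X X' Y Y' : Kleisli M} (f : X ⟶ X') (g : Y ⟶ Y') :
    kinl X Y ≫ kmap f g = f ≫ kinl X' Y' := by
  apply Kleisli.hom_ext
  ext x
  exact (pureHom_comp_apply _ _ _).trans (comp_pureHom_apply _ _ _).symm

theorem kinr_kmap {X X' Y Y' : Kleisli M} (f : X ⟶ X') (g : Y ⟶ Y') :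
    kinr X Y ≫ kmap f g = g ≫ kinr X' Y' := by
  apply Kleisli.hom_ext
  ext x
  exact (pureHom_comp_apply _ _ _).trans (comp_pureHom_apply _ _ _).symm

def kassoc (X Y Z : Kleisli M) : ksum (ksum X Y) Z ≅ ksum X (ksum Y Z) :=
  pureIso M (Equiv.sumAssoc X.of Y.of Z.of)

def kleft (X : Kleisli M) : ksum (.mk M PEmpty) X ≅ X := pureIso M (Equiv.emptySum PEmpty X.of)

def kright (X : Kleisli M) : ksum X (.mk M PEmpty) ≅ X := pureIso M (Equiv.sumEmpty X.of PEmpty)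

def kbraid (X Y : Kleisli M) : ksum X Y ≅ ksum Y X := pureIso M (Equiv.sumComm X.of Y.of)

theorem kassoc_ll (X Y Z : Kleisli M) :
    kinl X Y ≫ kinl (ksum X Y) Z ≫ (kassoc X Y Z).hom = kinl X (ksum Y Z) :=
  (congrArg (kinl X Y ≫ ·) (pureHom_comp _ _)).trans (pureHom_comp _ _)

theorem kassoc_lr (X Y Z : Kleisli M) :
    kinr X Y ≫ kinl (ksum X Y) Z ≫ (kassoc X Y Z).hom = kinl Y Z ≫ kinr X (ksum Y Z) :=
  ((congrArg (kinr X Y ≫ ·) (pureHom_comp _ _)).trans (pureHom_comp _ _)).trans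
    (pureHom_comp (X := Y) (Y := ksum Y Z) (Z := ksum X (ksum Y Z)) Sum.inl Sum.inr).symm

theorem kassoc_r (X Y Z : Kleisli M) :
    kinr (ksum X Y) Z ≫ (kassoc X Y Z).hom = kinr Y Z ≫ kinr X (ksum Y Z) :=
  (pureHom_comp _ _).trans
    (pureHom_comp (X := Z) (Y := ksum Y Z) (Z := ksum X (ksum Y Z)) Sum.inr Sum.inr).symm

theorem kassoc_inv_l (X Y Z : Kleisli M) :
    kinl X (ksum Y Z) ≫ (kassoc X Y Z).inv = kinl X Y ≫ kinl (ksum X Y) Z := by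
  rw [Iso.comp_inv_eq, Category.assoc, kassoc_ll]

theorem kassoc_inv_rl (X Y Z : Kleisli M) :
    kinl Y Z ≫ kinr X (ksum Y Z) ≫ (kassoc X Y Z).inv = kinr X Y ≫ kinl (ksum X Y) Z := by
  rw [← Category.assoc, Iso.comp_inv_eq, Category.assoc, kassoc_lr]

theorem kassoc_inv_rr (X Y Z : Kleisli M) :
    kinr Y Z ≫ kinr X (ksum Y Z) ≫ (kassoc X Y Z).inv = kinr (ksum X Y) Z := by
  rw [← Category.assoc, Iso.comp_inv_eq, kassoc_r]

theorem kleft_r (X : Kleisli M) : kinr (.mk M PEmpty) X ≫ (kleft X).hom = 𝟙 X :=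
  (pureHom_comp _ _).trans (pureHom_id X)

theorem kright_l (X : Kleisli M) : kinl X (.mk M PEmpty) ≫ (kright X).hom = 𝟙 X :=
  (pureHom_comp _ _).trans (pureHom_id X)

theorem kbraid_l (X Y : Kleisli M) : kinl X Y ≫ (kbraid X Y).hom = kinr Y X :=
  pureHom_comp _ _

theorem kbraid_r (X Y : Kleisli M) : kinr X Y ≫ (kbraid X Y).hom = kinl Y X :=
  pureHom_comp _ _

variable (M) in
/-- Disjoint union as a monoidal structure on the Kleisli category of a monad on sets. -/
@[reducible]
def kleisliSumStruct : MonoidalCategoryStruct (Kleisli M) where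
  tensorObj := ksum
  tensorHom := kmap
  whiskerLeft X _ _ g := kmap (𝟙 X) g
  whiskerRight f Y := kmap f (𝟙 Y)
  tensorUnit := .mk M PEmpty
  associator := kassoc
  leftUnitor := kleft
  rightUnitor := kright

theorem kmap_id (X Y : Kleisli M) : kmap (𝟙 X) (𝟙 Y) = 𝟙 (ksum X Y) := by
  apply ksum_ext <;> simp only [kinl_kmap, kinr_kmap, Category.id_comp, Category.comp_id]

theorem kmap_comp {X₁ Y₁ Z₁ X₂ Y₂ Z₂ : Kleisli M} (f₁ : X₁ ⟶ Y₁) (f₂ : X₂ ⟶ Y₂)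
    (g₁ : Y₁ ⟶ Z₁) (g₂ : Y₂ ⟶ Z₂) : kmap f₁ f₂ ≫ kmap g₁ g₂ = kmap (f₁ ≫ g₁) (f₂ ≫ g₂) := by
  apply ksum_ext <;> simp only [kinl_kmap, kinr_kmap, reassoc_of% kinl_kmap,
    reassoc_of% kinr_kmap, Category.assoc]

theorem kassoc_naturality {X₁ X₂ X₃ Y₁ Y₂ Y₃ : Kleisli M} (f₁ : X₁ ⟶ Y₁) (f₂ : X₂ ⟶ Y₂)
    (f₃ : X₃ ⟶ Y₃) : kmap (kmap f₁ f₂) f₃ ≫ (kassoc Y₁ Y₂ Y₃).hom =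
      (kassoc X₁ X₂ X₃).hom ≫ kmap f₁ (kmap f₂ f₃) := by
  refine ksum_ext (ksum_ext ?_ ?_) ?_ <;> simp only [kinl_kmap, kinr_kmap, reassoc_of% kinl_kmap,
    reassoc_of% kinr_kmap, kassoc_ll, kassoc_lr, kassoc_r, reassoc_of% kassoc_ll,
    reassoc_of% kassoc_lr, reassoc_of% kassoc_r]

theorem kleft_naturality {X Y : Kleisli M} (f : X ⟶ Y) :
    kmap (𝟙 (.mk M PEmpty)) f ≫ (kleft Y).hom = (kleft X).hom ≫ f := by
  refine ksum_ext (kempty_ext _ _) ?_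
  simp only [reassoc_of% kinr_kmap, kleft_r, reassoc_of% kleft_r, Category.comp_id]

theorem kright_naturality {X Y : Kleisli M} (f : X ⟶ Y) :
    kmap f (𝟙 (.mk M PEmpty)) ≫ (kright Y).hom = (kright X).hom ≫ f := by
  refine ksum_ext ?_ (kempty_ext _ _)
  simp only [reassoc_of% kinl_kmap, kright_l, reassoc_of% kright_l, Category.comp_id]

theorem kpentagon (X Y Z W : Kleisli M) :
    kmap (kassoc X Y Z).hom (𝟙 W) ≫ (kassoc X (ksum Y Z) W).hom ≫ kmap (𝟙 X) (kassoc Y Z W).hom =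
      (kassoc (ksum X Y) Z W).hom ≫ (kassoc X Y (ksum Z W)).hom := by
  refine ksum_ext (ksum_ext (ksum_ext ?_ ?_) ?_) ?_ <;>
    simp only [kinl_kmap, kinr_kmap, reassoc_of% kinl_kmap,
    reassoc_of% kinr_kmap, kassoc_ll, kassoc_lr, kassoc_r, reassoc_of% kassoc_ll,
    reassoc_of% kassoc_lr, reassoc_of% kassoc_r, Category.id_comp]

theorem ktriangle (X Y : Kleisli M) :
    (kassoc X (.mk M PEmpty) Y).hom ≫ kmap (𝟙 X) (kleft Y).hom = kmap (kright X).hom (𝟙 Y) := by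
  refine ksum_ext (ksum_ext ?_ (kempty_ext _ _)) ?_ <;>
    simp only [kinl_kmap, kinr_kmap, reassoc_of% kinl_kmap,
    reassoc_of% kinr_kmap, kassoc_ll, kassoc_lr, kassoc_r, reassoc_of% kassoc_ll,
    reassoc_of% kassoc_lr, reassoc_of% kassoc_r, reassoc_of% kright_l, reassoc_of% kleft_r,
    Category.id_comp]

variable (M) in
@[reducible]
def kleisliSum : MonoidalCategory (Kleisli M) :=
  letI := kleisliSumStruct M
  MonoidalCategory.ofTensorHom
    (id_tensorHom_id := kmap_id)
    (id_tensorHom := fun _ _ _ _ => rfl)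
    (tensorHom_id := fun _ _ => rfl)
    (tensorHom_comp_tensorHom := kmap_comp)
    (associator_naturality := kassoc_naturality)
    (leftUnitor_naturality := kleft_naturality)
    (rightUnitor_naturality := kright_naturality)
    (pentagon := kpentagon)
    (triangle := ktriangle)

theorem kbraid_naturality {X X' Y Y' : Kleisli M} (f : X ⟶ X') (g : Y ⟶ Y') :
    kmap f g ≫ (kbraid X' Y').hom = (kbraid X Y).hom ≫ kmap g f := by
  apply ksum_ext <;> simp only [kinl_kmap, kinr_kmap, reassoc_of% kinl_kmap,
    reassoc_of% kinr_kmap, kbraid_l, kbraid_r, reassoc_of% kbraid_l, reassoc_of% kbraid_r]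

theorem khexagon (X Y Z : Kleisli M) :
    (kassoc X Y Z).hom ≫ (kbraid X (ksum Y Z)).hom ≫ (kassoc Y Z X).hom =
      kmap (kbraid X Y).hom (𝟙 Z) ≫ (kassoc Y X Z).hom ≫ kmap (𝟙 Y) (kbraid X Z).hom := by
  refine ksum_ext (ksum_ext ?_ ?_) ?_ <;>
    simp only [kinl_kmap, kinr_kmap, reassoc_of% kinl_kmap,
    reassoc_of% kinr_kmap, kassoc_ll, kassoc_lr, kassoc_r, reassoc_of% kassoc_ll,
    reassoc_of% kassoc_lr, reassoc_of% kassoc_r, kbraid_l, kbraid_r, reassoc_of% kbraid_l,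
    reassoc_of% kbraid_r, Category.id_comp]

theorem khexagon' (X Y Z : Kleisli M) :
    (kassoc X Y Z).inv ≫ (kbraid (ksum X Y) Z).hom ≫ (kassoc Z X Y).inv =
      kmap (𝟙 X) (kbraid Y Z).hom ≫ (kassoc X Z Y).inv ≫ kmap (kbraid X Z).hom (𝟙 Y) := by
  refine ksum_ext ?_ (ksum_ext ?_ ?_) <;>
    simp only [kinl_kmap, kinr_kmap, reassoc_of% kinl_kmap, reassoc_of% kinr_kmap,
    kassoc_inv_l, kassoc_inv_rl, kassoc_inv_rr, reassoc_of% kassoc_inv_l,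
    reassoc_of% kassoc_inv_rl, reassoc_of% kassoc_inv_rr, kbraid_l, kbraid_r,
    reassoc_of% kbraid_l, reassoc_of% kbraid_r, Category.id_comp]

theorem ksymm (X Y : Kleisli M) : (kbraid X Y).hom ≫ (kbraid Y X).hom = 𝟙 (ksum X Y) := by
  apply ksum_ext <;> simp only [reassoc_of% kbraid_l, reassoc_of% kbraid_r, kbraid_l, kbraid_r,
    Category.comp_id]

/-- Disjoint union, with the evident symmetry, as a symmetric monoidal structure on the Kleisli
category of a monad on sets. -/
instance kleisliSymmetricSum : SymmetricSum (Kleisli M) where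
  monoidal := kleisliSum M
  symmetric :=
    letI := kleisliSum M
    { braiding := kbraid
      braiding_naturality_right := fun X _ _ f => kbraid_naturality (𝟙 X) f
      braiding_naturality_left := fun f Z => kbraid_naturality f (𝟙 Z)
      hexagon_forward := khexagon
      hexagon_reverse := khexagon'
      symmetry := ksymm }

end KleisliType

section Result

open scoped ComonObj

variable {T : AlgebraicTheory.{u}} [SymmetricMonoidalMonad (termMonad T)]

/-- The structure of `T`-copy discard rig category `R` on the Kleisli category of the term monad,
with `⊗` induced by the product of sets and `⊕` by the disjoint union, is the standard one: the
symmetry of `⊗`, the distributors, the annihilators, the comonoids and the monoids are the images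
of the corresponding functions between sets. -/
structure IsStandard (R : TCDRigCategory T (Kleisli (termMonad T))) : Prop where
  braid (X Y : Kleisli (termMonad T)) :
    letI := R.fccd.cd
    (β_ X Y).hom = pureHom (X := X ⊗ Y) (Y := Y ⊗ X) _ fun p => (p.2, p.1)
  copy (X : Kleisli (termMonad T)) :
    letI := R.fccd.cd
    Δ[X] = pureHom (Y := X ⊗ X) _ fun x => (x, x)
  discard (X : Kleisli (termMonad T)) :
    letI := R.fccd.cd
    ε[X] = pureHom (Y := 𝟙_ _) _ fun _ => PUnit.unit
  codiag (X : Kleisli (termMonad T)) :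
    letI := R.fccd.fc
    sumCodiag X = pureHom (X := X ⊕ₒ X) _ (Sum.elim id id)
  cobang (X : Kleisli (termMonad T)) :
    letI := R.fccd.fc
    sumCobang X = pureHom (X := sumZero _) _ PEmpty.elim
  dl (X Y Z : Kleisli (termMonad T)) :
    letI := R.fccd.cd
    (R.fccd.rig.dl X Y Z).hom =
      pureHom (X := X ⊗ (Y ⊕ₒ Z)) (Y := (X ⊗ Y) ⊕ₒ (X ⊗ Z)) _
        (Equiv.prodSumDistrib X.of Y.of Z.of)
  dr (X Y Z : Kleisli (termMonad T)) :
    letI := R.fccd.cd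
    (R.fccd.rig.dr X Y Z).hom =
      pureHom (X := (X ⊕ₒ Y) ⊗ Z) (Y := (X ⊗ Z) ⊕ₒ (Y ⊗ Z)) _
        (Equiv.sumProdDistrib X.of Y.of Z.of)
  annl (X : Kleisli (termMonad T)) :
    letI := R.fccd.cd
    (R.fccd.rig.annl X).hom = pureHom (X := sumZero _ ⊗ X) (Y := sumZero _) _ Prod.fst
  annr (X : Kleisli (termMonad T)) :
    letI := R.fccd.cd
    (R.fccd.rig.annr X).hom = pureHom (X := X ⊗ sumZero _) (Y := sumZero _) _ Prod.snd

end Result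
end TRig

open TRig

/-! Every structural arrow of the Kleisli category is the image `pureHom` of a function. Since
`pureHom` is functorial and carries disjoint unions and products of functions to `⊕` and `⊗`
(`pureHom_comp`, `sumHom_pureHom`, `tensorHom_pureHom`), each coherence axiom reduces to an equation
between functions, checked on elements.

What remains is naturality against arbitrary Kleisli arrows. For the symmetry of `⊗` it is the
symmetry axiom of `m`. For the distributors it is naturality of `m`, which moves a coproduct
injection out of `m`. For `∇` it follows from the universal property of the disjoint union, which is
still a coproduct in the Kleisli category. Arrows out of an empty set agree trivially, which settles
the annihilators and `!`.

For the structure map, the sum of an fc category is a coproduct, so a functor between fc categories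
has canonical comparison arrows, and if these are invertible it is a morphism of fc categories
(`FCFunctor.ofComparison`). For `lawvereToKleisli` the comparison is the bijection between the
disjoint union of the ordinals `n` and `m` and the ordinal `n + m`. This functor sends `n` to an
ordinal and not to the iterated sum, so it does not satisfy `i ∘ d = c` strictly. Conjugating it by
the isomorphisms `nsumIsoOrd` gives `lawvereToSums`, for which the equation is strict; invertibility
of the comparisons transfers along the natural isomorphism. -/

namespace TRig

/-! ### Structural arrows as images of functions; the symmetry of `⊗`. -/

section Pure

variable {M : Monad (Type u)}

theorem pureHom_congr {X Y : Kleisli M} {f g : X.of → Y.of} (h : ∀ x, f x = g x) :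
    pureHom M f = pureHom M g :=
  congrArg _ (funext h)

/-! The functions between disjoint unions which give the structure of `⊕`. -/

def assocFun (X Y Z : Kleisli M) : ((X ⊕ₒ Y) ⊕ₒ Z).of → (X ⊕ₒ Y ⊕ₒ Z).of :=
  Equiv.sumAssoc X.of Y.of Z.of
def assocInvFun (X Y Z : Kleisli M) : (X ⊕ₒ Y ⊕ₒ Z).of → ((X ⊕ₒ Y) ⊕ₒ Z).of :=
  (Equiv.sumAssoc X.of Y.of Z.of).symm
def leftFun (X : Kleisli M) : (sumZero (Kleisli M) ⊕ₒ X).of → X.of :=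
  Equiv.emptySum PEmpty X.of
def leftInvFun (X : Kleisli M) : X.of → (sumZero (Kleisli M) ⊕ₒ X).of := Sum.inr
def rightFun (X : Kleisli M) : (X ⊕ₒ sumZero (Kleisli M)).of → X.of :=
  Equiv.sumEmpty X.of PEmpty
def rightInvFun (X : Kleisli M) : X.of → (X ⊕ₒ sumZero (Kleisli M)).of := Sum.inl
def braidFun (X Y : Kleisli M) : (X ⊕ₒ Y).of → (Y ⊕ₒ X).of := Sum.swap
def sumFun {X X' Y Y' : Kleisli M} (f : X.of → X'.of) (g : Y.of → Y'.of) :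
    (X ⊕ₒ Y).of → (X' ⊕ₒ Y').of := Sum.map f g
def midFun (X₁ X₂ Y₁ Y₂ : Kleisli M) :
    ((X₁ ⊕ₒ X₂) ⊕ₒ (Y₁ ⊕ₒ Y₂)).of → ((X₁ ⊕ₒ Y₁) ⊕ₒ (X₂ ⊕ₒ Y₂)).of :=
  Sum.elim (Sum.map Sum.inl Sum.inl) (Sum.map Sum.inr Sum.inr)

/-- This and the similar `rfl` equations below serve as rewriting rules: they put structural arrows
in the form `pureHom`, so that `pureHom_comp` can collapse a whole diagram to one function on each
side. -/
theorem sumAssoc_hom_eq (X Y Z : Kleisli M) :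
    (sumAssoc X Y Z).hom = pureHom M (assocFun X Y Z) := rfl

theorem sumAssoc_inv_eq (X Y Z : Kleisli M) :
    (sumAssoc X Y Z).inv = pureHom M (assocInvFun X Y Z) := rfl

theorem sumLeft_hom_eq (X : Kleisli M) : (sumLeft X).hom = pureHom M (leftFun X) := rfl

theorem sumLeft_inv_eq (X : Kleisli M) : (sumLeft X).inv = pureHom M (leftInvFun X) := rfl

theorem sumRight_hom_eq (X : Kleisli M) : (sumRight X).hom = pureHom M (rightFun X) := rfl

theorem sumRight_inv_eq (X : Kleisli M) : (sumRight X).inv = pureHom M (rightInvFun X) := rfl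

theorem sumBraid_hom_eq (X Y : Kleisli M) : (sumBraid X Y).hom = pureHom M (braidFun X Y) := rfl

theorem sumHom_pureHom {X X' Y Y' : Kleisli M} (f : X.of → X'.of) (g : Y.of → Y'.of) :
    pureHom M f ⊕ₘ pureHom M g = pureHom M (sumFun f g) := by
  apply ksum_ext
  · exact (kinl_kmap _ _).trans ((pureHom_comp _ _).trans
      (pureHom_comp (Y := ksum X Y) (Z := ksum X' Y') Sum.inl (Sum.map f g)).symm)
  · exact (kinr_kmap _ _).trans ((pureHom_comp _ _).trans
      (pureHom_comp (Y := ksum X Y) (Z := ksum X' Y') Sum.inr (Sum.map f g)).symm)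

theorem sumHom_pureHom_id {X X' Y : Kleisli M} (f : X.of → X'.of) :
    pureHom M f ⊕ₘ 𝟙 Y = pureHom M (sumFun f fun y : Y.of => y) := by
  rw [← pureHom_id, sumHom_pureHom]

theorem sumHom_id_pureHom {X Y Y' : Kleisli M} (g : Y.of → Y'.of) :
    𝟙 X ⊕ₘ pureHom M g = pureHom M (sumFun (fun x : X.of => x) g) := by
  rw [← pureHom_id, sumHom_pureHom]

theorem sumMid_eq (X₁ X₂ Y₁ Y₂ : Kleisli M) :
    sumMid X₁ X₂ Y₁ Y₂ = pureHom M (midFun X₁ X₂ Y₁ Y₂) := by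
  -- Whiskering for `⊕` is by definition a sum with an identity, so `tensorμ` unfolds to sums of
  -- structural arrows.
  change (sumAssoc _ _ _).hom ≫ (𝟙 _ ⊕ₘ (sumAssoc _ _ _).inv) ≫
    (𝟙 _ ⊕ₘ ((sumBraid _ _).hom ⊕ₘ 𝟙 _)) ≫
      (𝟙 _ ⊕ₘ (sumAssoc _ _ _).hom) ≫ (sumAssoc _ _ _).inv = _
  simp only [sumAssoc_hom_eq, sumAssoc_inv_eq, sumBraid_hom_eq, sumHom_pureHom_id,
    sumHom_id_pureHom, pureHom_comp]
  refine pureHom_congr ?_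
  rintro ((x | x) | (x | x)) <;> rfl

variable [N : SymmetricMonoidalMonad M]

/-! The functions between products which give the structure of `⊗`. -/

def tensorFun {X X' Y Y' : Kleisli M} (f : X.of → X'.of) (g : Y.of → Y'.of) :
    (X ⊗ Y).of → (X' ⊗ Y').of := Prod.map f g
def tassocFun (X Y Z : Kleisli M) : ((X ⊗ Y) ⊗ Z).of → (X ⊗ Y ⊗ Z).of :=
  Equiv.prodAssoc X.of Y.of Z.of
def tassocInvFun (X Y Z : Kleisli M) : (X ⊗ Y ⊗ Z).of → ((X ⊗ Y) ⊗ Z).of :=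
  (Equiv.prodAssoc X.of Y.of Z.of).symm
def tleftFun (X : Kleisli M) : (𝟙_ (Kleisli M) ⊗ X).of → X.of := Prod.snd
def tleftInvFun (X : Kleisli M) : X.of → (𝟙_ (Kleisli M) ⊗ X).of := fun x => (PUnit.unit, x)
def trightFun (X : Kleisli M) : (X ⊗ 𝟙_ (Kleisli M)).of → X.of := Prod.fst
def trightInvFun (X : Kleisli M) : X.of → (X ⊗ 𝟙_ (Kleisli M)).of := fun x => (x, PUnit.unit)
def tbraidFun (X Y : Kleisli M) : (X ⊗ Y).of → (Y ⊗ X).of := fun p => (p.2, p.1)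
def tmidFun (X₁ X₂ Y₁ Y₂ : Kleisli M) :
    ((X₁ ⊗ X₂) ⊗ (Y₁ ⊗ Y₂)).of → ((X₁ ⊗ Y₁) ⊗ (X₂ ⊗ Y₂)).of :=
  fun p => ((p.1.1, p.2.1), (p.1.2, p.2.2))

/-- This is the unit axiom of `m`: a pair of pure values is sent to the pure pair. -/
theorem tensorHom_pureHom {X X' Y Y' : Kleisli M} (f : X.of → X'.of) (g : Y.of → Y'.of) :
    pureHom M f ⊗ₘ pureHom M g = pureHom M (tensorFun f g) :=
  N.kleisli_tensor_map (↾f) (↾g)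

theorem pureHom_whiskerRight {X X' : Kleisli M} (f : X.of → X'.of) (Y : Kleisli M) :
    pureHom M f ▷ Y = pureHom M (tensorFun f fun y : Y.of => y) := by
  rw [← tensorHom_id, ← pureHom_id, tensorHom_pureHom]

theorem whiskerLeft_pureHom (X : Kleisli M) {Y Y' : Kleisli M} (g : Y.of → Y'.of) :
    X ◁ pureHom M g = pureHom M (tensorFun (fun x : X.of => x) g) := by
  rw [← id_tensorHom, ← pureHom_id, tensorHom_pureHom]

theorem associator_hom_eq (X Y Z : Kleisli M) : (α_ X Y Z).hom = pureHom M (tassocFun X Y Z) := rfl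

theorem associator_inv_eq (X Y Z : Kleisli M) :
    (α_ X Y Z).inv = pureHom M (tassocInvFun X Y Z) := rfl

theorem leftUnitor_hom_eq (X : Kleisli M) : (λ_ X).hom = pureHom M (tleftFun X) := rfl

theorem leftUnitor_inv_eq (X : Kleisli M) : (λ_ X).inv = pureHom M (tleftInvFun X) := rfl

theorem rightUnitor_hom_eq (X : Kleisli M) : (ρ_ X).hom = pureHom M (trightFun X) := rfl

theorem rightUnitor_inv_eq (X : Kleisli M) : (ρ_ X).inv = pureHom M (trightInvFun X) := rfl

/-- The symmetry of `⊗`. -/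
def tbraid (X Y : Kleisli M) : X ⊗ Y ≅ Y ⊗ X :=
  pureIso M (X := X ⊗ Y) (Y := Y ⊗ X) (Equiv.prodComm X.of Y.of)

theorem tbraid_hom_eq (X Y : Kleisli M) :
    (tbraid X Y).hom = pureHom M (tbraidFun X Y) := rfl

/-- Here `f` and `g` need not be pure, so computing with functions is not enough. The claim is the
symmetry axiom of `m`, evaluated at the pair of values of `f` and `g`. -/
theorem tbraid_naturality {X X' Y Y' : Kleisli M} (f : X ⟶ X') (g : Y ⟶ Y') :
    (f ⊗ₘ g) ≫ (tbraid X' Y').hom = (tbraid X Y).hom ≫ (g ⊗ₘ f) := by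
  apply Kleisli.hom_ext
  ext p
  refine (comp_pureHom_apply _ _ _).trans (Eq.trans ?_ (pureHom_comp_apply _ _ _).symm)
  exact ConcreteCategory.congr_hom (N.symm X'.of Y'.of)
    ((f.of p.1, g.of p.2) : M.obj X'.of × M.obj Y'.of)

@[reducible]
def kleisliSymmetric : SymmetricCategory (Kleisli M) where
  braiding := tbraid
  braiding_naturality_right X _ _ f := by
    rw [← id_tensorHom, ← tensorHom_id, tbraid_naturality]
  braiding_naturality_left f Z := by
    rw [← id_tensorHom, ← tensorHom_id, tbraid_naturality]
  hexagon_forward X Y Z := by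
    simp only [tbraid_hom_eq, associator_hom_eq, pureHom_whiskerRight, whiskerLeft_pureHom,
      pureHom_comp]
    rfl
  hexagon_reverse X Y Z := by
    simp only [tbraid_hom_eq, associator_inv_eq, pureHom_whiskerRight, whiskerLeft_pureHom,
      pureHom_comp]
    rfl
  symmetry X Y := by
    simp only [tbraid_hom_eq, pureHom_comp]
    exact pureHom_id _

end Pure

/-! ### The copy-discard structure of `(⊗, 1)`. -/

section CopyDiscard

variable {M : Monad (Type u)} [N : SymmetricMonoidalMonad M]

attribute [local instance] kleisliSymmetric

theorem braiding_hom_eq (X Y : Kleisli M) :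
    (β_ X Y).hom = pureHom M (tbraidFun X Y) := rfl

theorem tensorμ_eq (X₁ X₂ Y₁ Y₂ : Kleisli M) :
    tensorμ X₁ X₂ Y₁ Y₂ = pureHom M (tmidFun X₁ X₂ Y₁ Y₂) := by
  simp only [tensorμ, braiding_hom_eq, associator_hom_eq, associator_inv_eq,
    pureHom_whiskerRight, whiskerLeft_pureHom, pureHom_comp]
  rfl

/-- The comonoid structure of an object of the Kleisli category given by the diagonal. -/
@[reducible]
def kleisliComon (X : Kleisli M) : ComonObj X where
  counit := pureHom M (Y := 𝟙_ _) fun _ => PUnit.unit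
  comul := pureHom M (Y := X ⊗ X) fun x => (x, x)
  counit_comul := by
    simp only [leftUnitor_inv_eq, pureHom_whiskerRight, pureHom_comp]
    rfl
  comul_counit := by
    simp only [rightUnitor_inv_eq, whiskerLeft_pureHom, pureHom_comp]
    rfl
  comul_assoc := by
    simp only [associator_hom_eq, whiskerLeft_pureHom, pureHom_whiskerRight, pureHom_comp]
    rfl

variable (M) in
/-- The Kleisli category of a symmetric monoidal monad on sets as a copy-discard category. -/
@[reducible]
def kleisliCopyDiscard : CopyDiscardCategory (Kleisli M) where
  toSymmetricCategory := kleisliSymmetric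
  comonObj := kleisliComon
  isCommComonObj X :=
    letI := kleisliComon X
    { comul_comm := by
        simp only [ComonObj.comul, braiding_hom_eq, pureHom_comp]
        rfl }
  copy_tensor X Y := by
    simp only [ComonObj.comul, tensorμ_eq, tensorHom_pureHom, pureHom_comp]
    rfl
  discard_tensor X Y := by
    simp only [ComonObj.counit, leftUnitor_hom_eq, tensorHom_pureHom, pureHom_comp]
    rfl
  copy_unit := by
    simp only [ComonObj.comul, leftUnitor_inv_eq]
    rfl
  discard_unit := by
    simp only [ComonObj.counit, ← pureHom_id]
    rfl

end CopyDiscard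
end TRig

namespace TRig
-- Distributors, annihilators and Laplaza's axioms.
section RigStructure

variable {M : Monad (Type u)} [N : SymmetricMonoidalMonad M]

attribute [local instance] kleisliSymmetric

/-! The functions which give the distributors and the annihilators. -/

def dlFun (X Y Z : Kleisli M) : (X ⊗ (Y ⊕ₒ Z)).of → ((X ⊗ Y) ⊕ₒ (X ⊗ Z)).of :=
  Equiv.prodSumDistrib X.of Y.of Z.of
def drFun (X Y Z : Kleisli M) : ((X ⊕ₒ Y) ⊗ Z).of → ((X ⊗ Z) ⊕ₒ (Y ⊗ Z)).of :=
  Equiv.sumProdDistrib X.of Y.of Z.of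
def dlInvFun (X Y Z : Kleisli M) : ((X ⊗ Y) ⊕ₒ (X ⊗ Z)).of → (X ⊗ (Y ⊕ₒ Z)).of :=
  (Equiv.prodSumDistrib X.of Y.of Z.of).symm
def drInvFun (X Y Z : Kleisli M) : ((X ⊗ Z) ⊕ₒ (Y ⊗ Z)).of → ((X ⊕ₒ Y) ⊗ Z).of :=
  (Equiv.sumProdDistrib X.of Y.of Z.of).symm
def annlFun (X : Kleisli M) : (sumZero (Kleisli M) ⊗ X).of → (sumZero (Kleisli M)).of := Prod.fst
def annrFun (X : Kleisli M) : (X ⊗ sumZero (Kleisli M)).of → (sumZero (Kleisli M)).of := Prod.snd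

def kdl (X Y Z : Kleisli M) : X ⊗ (Y ⊕ₒ Z) ≅ (X ⊗ Y) ⊕ₒ (X ⊗ Z) :=
  pureIso M (X := X ⊗ (Y ⊕ₒ Z)) (Y := (X ⊗ Y) ⊕ₒ (X ⊗ Z)) (Equiv.prodSumDistrib X.of Y.of Z.of)
def kdr (X Y Z : Kleisli M) : (X ⊕ₒ Y) ⊗ Z ≅ (X ⊗ Z) ⊕ₒ (Y ⊗ Z) :=
  pureIso M (X := (X ⊕ₒ Y) ⊗ Z) (Y := (X ⊗ Z) ⊕ₒ (Y ⊗ Z)) (Equiv.sumProdDistrib X.of Y.of Z.of)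
def kannl (X : Kleisli M) : sumZero (Kleisli M) ⊗ X ≅ sumZero (Kleisli M) :=
  pureIso M (X := sumZero _ ⊗ X) (Y := sumZero _)
    ⟨Prod.fst, PEmpty.elim, fun p => p.1.elim, fun p => p.elim⟩
def kannr (X : Kleisli M) : X ⊗ sumZero (Kleisli M) ≅ sumZero (Kleisli M) :=
  pureIso M (X := X ⊗ sumZero _) (Y := sumZero _)
    ⟨Prod.snd, PEmpty.elim, fun p => p.2.elim, fun p => p.elim⟩

theorem kdl_hom_eq (X Y Z : Kleisli M) : (kdl X Y Z).hom = pureHom M (dlFun X Y Z) := rfl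
theorem kdr_hom_eq (X Y Z : Kleisli M) : (kdr X Y Z).hom = pureHom M (drFun X Y Z) := rfl
theorem kdl_inv_eq (X Y Z : Kleisli M) : (kdl X Y Z).inv = pureHom M (dlInvFun X Y Z) := rfl
theorem kdr_inv_eq (X Y Z : Kleisli M) : (kdr X Y Z).inv = pureHom M (drInvFun X Y Z) := rfl
theorem kannl_hom_eq (X : Kleisli M) : (kannl X).hom = pureHom M (annlFun X) := rfl
theorem kannr_hom_eq (X : Kleisli M) : (kannr X).hom = pureHom M (annrFun X) := rfl

theorem map_m {A A' B B' : Type u} (f : A → A') (g : B → B') (a : M.obj A) (b : M.obj B) :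
    N.m A' B' ((M.map (↾f) a, M.map (↾g) b) : M.obj A' × M.obj B') =
      M.map (↾(Prod.map f g)) (N.m A B ((a, b) : M.obj A × M.obj B)) :=
  ConcreteCategory.congr_hom (SymmetricMonoidalMonad.naturality (T := M) (↾f) (↾g))
    ((a, b) : M.obj A × M.obj B)

theorem map_map {A B C : Type u} (f : A → B) (g : B → C) (a : M.obj A) :
    M.map (↾g) (M.map (↾f) a) = M.map (↾fun x => g (f x)) a :=
  (ConcreteCategory.congr_hom (M.map_comp (↾f) (↾g)) a).symm

/-- On a summand, the value of `g` or `h` enters `m` after an injection has been applied to it.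
Naturality of `m` in its second argument moves the injection outside, where the distributor turns it
into an injection of the sum of products. -/
theorem kdl_naturality {X X' Y Y' Z Z' : Kleisli M} (f : X ⟶ X') (g : Y ⟶ Y') (h : Z ⟶ Z') :
    (f ⊗ₘ (g ⊕ₘ h)) ≫ (kdl X' Y' Z').hom = (kdl X Y Z).hom ≫ ((f ⊗ₘ g) ⊕ₘ (f ⊗ₘ h)) := by
  apply Kleisli.hom_ext
  ext ⟨x, y | z⟩
  · refine (comp_pureHom_apply _ _ _).trans (Eq.trans ?_ (pureHom_comp_apply _ _ _).symm)
    have h₁ := map_m id Sum.inl (B' := Y'.of ⊕ Z'.of) (f.of x) (g.of y)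
    -- Only the second argument of `m` is moved, so the identity inserted in the first one has to be
    -- removed.
    have h₂ : M.map (↾id) (f.of x) = f.of x := ConcreteCategory.congr_hom (M.map_id _) _
    rw [h₂] at h₁
    exact (congrArg _ h₁).trans (map_map _ _ _)
  · refine (comp_pureHom_apply _ _ _).trans (Eq.trans ?_ (pureHom_comp_apply _ _ _).symm)
    have h₁ := map_m id Sum.inr (B' := Y'.of ⊕ Z'.of) (f.of x) (h.of z)
    have h₂ : M.map (↾id) (f.of x) = f.of x := ConcreteCategory.congr_hom (M.map_id _) _
    rw [h₂] at h₁
    exact (congrArg _ h₁).trans (map_map _ _ _)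

theorem kdr_naturality {X X' Y Y' Z Z' : Kleisli M} (f : X ⟶ X') (g : Y ⟶ Y') (h : Z ⟶ Z') :
    ((f ⊕ₘ g) ⊗ₘ h) ≫ (kdr X' Y' Z').hom = (kdr X Y Z).hom ≫ ((f ⊗ₘ h) ⊕ₘ (g ⊗ₘ h)) := by
  apply Kleisli.hom_ext
  ext ⟨x | y, z⟩
  · refine (comp_pureHom_apply _ _ _).trans (Eq.trans ?_ (pureHom_comp_apply _ _ _).symm)
    have h₁ := map_m Sum.inl id (A' := X'.of ⊕ Y'.of) (f.of x) (h.of z)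
    have h₂ : M.map (↾id) (h.of z) = h.of z := ConcreteCategory.congr_hom (M.map_id _) _
    rw [h₂] at h₁
    exact (congrArg _ h₁).trans (map_map _ _ _)
  · refine (comp_pureHom_apply _ _ _).trans (Eq.trans ?_ (pureHom_comp_apply _ _ _).symm)
    have h₁ := map_m Sum.inr id (A' := X'.of ⊕ Y'.of) (g.of y) (h.of z)
    have h₂ : M.map (↾id) (h.of z) = h.of z := ConcreteCategory.congr_hom (M.map_id _) _
    rw [h₂] at h₁
    exact (congrArg _ h₁).trans (map_map _ _ _)

/-- Settles the axioms of the annihilators whose source is a product with an empty factor. -/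
theorem hom_ext_of_isEmpty {X Y : Kleisli M} (h : X.of → False) (f g : X ⟶ Y) : f = g := by
  apply Kleisli.hom_ext
  ext x
  exact (h x).elim

variable (M) in
/-- The Kleisli category of a symmetric monoidal monad on sets as a rig category. -/
@[reducible]
def kleisliRig : RigCategory (Kleisli M) where
  dl := kdl
  dr := kdr
  annl := kannl
  annr := kannr
  dl_naturality := kdl_naturality
  dr_naturality := kdr_naturality
  annl_naturality f := hom_ext_of_isEmpty (by rintro ⟨p, _⟩; exact p.elim) _ _
  annr_naturality f := hom_ext_of_isEmpty (by rintro ⟨_, p⟩; exact p.elim) _ _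
  dl_sumBraid X Y Z := by
    simp only [kdl_hom_eq, sumBraid_hom_eq, whiskerLeft_pureHom, pureHom_comp]
    -- The distributor is defined by cases, so the two functions agree by computation only once the
    -- summand of the argument is known.
    refine pureHom_congr ?_
    rintro ⟨x, y | y⟩ <;> rfl
  dr_sumBraid X Y Z := by
    simp only [kdr_hom_eq, sumBraid_hom_eq, pureHom_whiskerRight, pureHom_comp]
    refine pureHom_congr ?_
    rintro ⟨x | x, y⟩ <;> rfl
  braid_dl X Y Z := by
    simp only [kdl_hom_eq, kdr_hom_eq, braiding_hom_eq, sumHom_pureHom, pureHom_comp]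
    refine pureHom_congr ?_
    rintro ⟨x | x, y⟩ <;> rfl
  dl_sumAssoc X Y Z W := by
    simp only [kdl_hom_eq, sumAssoc_hom_eq, sumHom_pureHom_id, sumHom_id_pureHom,
      whiskerLeft_pureHom, pureHom_comp]
    refine pureHom_congr ?_
    rintro ⟨x, (y | y) | y⟩ <;> rfl
  dr_sumAssoc X Y Z W := by
    simp only [kdr_hom_eq, sumAssoc_hom_eq, sumHom_pureHom_id, sumHom_id_pureHom,
      pureHom_whiskerRight, pureHom_comp]
    refine pureHom_congr ?_
    rintro ⟨(x | x) | x, y⟩ <;> rfl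
  dl_assoc X Y Z W := by
    simp only [kdl_hom_eq, associator_hom_eq, sumHom_pureHom, whiskerLeft_pureHom, pureHom_comp]
    refine pureHom_congr ?_
    rintro ⟨x, y | y⟩ <;> rfl
  dr_assoc X Y Z W := by
    simp only [kdr_hom_eq, associator_hom_eq, sumHom_pureHom, pureHom_whiskerRight, pureHom_comp]
    refine pureHom_congr ?_
    rintro ⟨⟨x | x, y⟩, z⟩ <;> rfl
  dl_dr_assoc X Y Z W := by
    simp only [kdl_hom_eq, kdr_hom_eq, associator_hom_eq, sumHom_pureHom, pureHom_whiskerRight,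
      whiskerLeft_pureHom, pureHom_comp]
    refine pureHom_congr ?_
    rintro ⟨⟨x, y | y⟩, z⟩ <;> rfl
  dr_dl X Y Z W := by
    simp only [kdl_hom_eq, kdr_hom_eq, sumMid_eq, sumHom_pureHom, pureHom_comp]
    refine pureHom_congr ?_
    rintro ⟨x | x, y | y⟩ <;> rfl
  annl_zero := hom_ext_of_isEmpty (by rintro ⟨p, _⟩; exact p.elim) _ _
  annl_sum X Y := hom_ext_of_isEmpty (by rintro ⟨p, _⟩; exact p.elim) _ _
  annr_sum X Y := hom_ext_of_isEmpty (by rintro ⟨_, p⟩; exact p.elim) _ _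
  annl_one := hom_ext_of_isEmpty (by rintro ⟨p, _⟩; exact p.elim) _ _
  annr_one := hom_ext_of_isEmpty (by rintro ⟨_, p⟩; exact p.elim) _ _
  annr_braid X := hom_ext_of_isEmpty (by rintro ⟨_, p⟩; exact p.elim) _ _
  annl_tensor X Y := hom_ext_of_isEmpty (by rintro ⟨⟨p, _⟩, _⟩; exact p.elim) _ _
  annr_annl_tensor X Y := hom_ext_of_isEmpty (by rintro ⟨⟨_, p⟩, _⟩; exact p.elim) _ _
  annr_tensor X Y := hom_ext_of_isEmpty (by rintro ⟨_, p⟩; exact p.elim) _ _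
  dl_sumLeft X Y := by
    simp only [kdl_hom_eq, kannr_hom_eq, sumLeft_hom_eq, sumHom_pureHom_id, whiskerLeft_pureHom,
      pureHom_comp]
    refine pureHom_congr ?_
    rintro ⟨x, y | y⟩
    · exact y.elim
    · rfl
  dr_sumLeft X Y := by
    simp only [kdr_hom_eq, kannl_hom_eq, sumLeft_hom_eq, sumHom_pureHom_id, pureHom_whiskerRight,
      pureHom_comp]
    refine pureHom_congr ?_
    rintro ⟨x | x, y⟩
    · exact x.elim
    · rfl
  dl_sumRight X Y := by
    simp only [kdl_hom_eq, kannr_hom_eq, sumRight_hom_eq, sumHom_id_pureHom, whiskerLeft_pureHom,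
      pureHom_comp]
    refine pureHom_congr ?_
    rintro ⟨x, y | y⟩
    · rfl
    · exact y.elim
  dr_sumRight X Y := by
    simp only [kdr_hom_eq, kannl_hom_eq, sumRight_hom_eq, sumHom_id_pureHom, pureHom_whiskerRight,
      pureHom_comp]
    refine pureHom_congr ?_
    rintro ⟨x | x, y⟩
    · rfl
    · exact x.elim
  dl_one X Y := by
    simp only [kdl_hom_eq, leftUnitor_hom_eq, sumHom_pureHom, pureHom_comp]
    refine pureHom_congr ?_
    rintro ⟨x, y | y⟩ <;> rfl
  dr_one X Y := by
    simp only [kdr_hom_eq, rightUnitor_hom_eq, sumHom_pureHom, pureHom_comp]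
    refine pureHom_congr ?_
    rintro ⟨x | x, y⟩ <;> rfl

end RigStructure
end TRig

namespace TRig
-- Functors between fc categories; here `⊗` denotes the sum.
section FCLemmas

open scoped MonObj

variable {C : Type u₁} [Category.{v₁} C] [MonoidalCategory C] [SymmetricCategory C]
  [FiniteCoproductCategory C]

/-- The uniqueness half of the universal property of the coproduct: the identity is the copairing of
the injections, and copairings absorb postcomposition. -/
theorem sum_hom_ext {X Y Z : C} {f g : X ⊗ Y ⟶ Z} (h₁ : inl X Y ≫ f = inl X Y ≫ g)
    (h₂ : inr X Y ≫ f = inr X Y ≫ g) : f = g := by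
  rw [← Category.id_comp f, ← Category.id_comp g, ← copair_inl_inr, copair_comp, copair_comp, h₁,
    h₂]

/-- The unit is initial: its identity is its cobang, and naturality of the cobang makes any arrow
out of it a cobang. -/
theorem unit_hom_ext {Z : C} (f g : 𝟙_ C ⟶ Z) : f = g := by
  rw [← Category.id_comp f, ← Category.id_comp g, ← FiniteCoproductCategory.cobang_unit,
    FiniteCoproductCategory.cobang_naturality, FiniteCoproductCategory.cobang_naturality]

/-- Naturality of the cobang absorbs `g`. -/
theorem inl_tensorHom {X X' Y Y' : C} (f : X ⟶ X') (g : Y ⟶ Y') :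
    inl X Y ≫ (f ⊗ₘ g) = f ≫ inl X' Y' := by
  rw [inl, inl, Category.assoc, MonoidalCategory.tensorHom_def', ← whiskerLeft_comp_assoc,
    FiniteCoproductCategory.cobang_naturality, whisker_exchange, rightUnitor_inv_naturality_assoc]

theorem inr_tensorHom {X X' Y Y' : C} (f : X ⟶ X') (g : Y ⟶ Y') :
    inr X Y ≫ (f ⊗ₘ g) = g ≫ inr X' Y' := by
  rw [inr, inr, Category.assoc, MonoidalCategory.tensorHom_def, ← comp_whiskerRight_assoc,
    FiniteCoproductCategory.cobang_naturality, ← whisker_exchange,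
    leftUnitor_inv_naturality_assoc]

theorem inl_whiskerRight {X X' : C} (f : X ⟶ X') (Y : C) :
    inl X Y ≫ f ▷ Y = f ≫ inl X' Y := by rw [← tensorHom_id, inl_tensorHom]

theorem inr_whiskerRight {X X' : C} (f : X ⟶ X') (Y : C) :
    inr X Y ≫ f ▷ Y = inr X' Y := by rw [← tensorHom_id, inr_tensorHom, Category.id_comp]

theorem inl_whiskerLeft (X : C) {Y Y' : C} (g : Y ⟶ Y') :
    inl X Y ≫ X ◁ g = inl X Y' := by rw [← id_tensorHom, inl_tensorHom, Category.id_comp]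

theorem inr_whiskerLeft (X : C) {Y Y' : C} (g : Y ⟶ Y') :
    inr X Y ≫ X ◁ g = g ≫ inr X Y' := by rw [← id_tensorHom, inr_tensorHom]

theorem inr_leftUnitor (X : C) : inr (𝟙_ C) X ≫ (λ_ X).hom = 𝟙 X := by
  simp [inr, FiniteCoproductCategory.cobang_unit]

theorem inl_rightUnitor (X : C) : inl X (𝟙_ C) ≫ (ρ_ X).hom = 𝟙 X := by
  simp [inl, FiniteCoproductCategory.cobang_unit]

theorem inl_braiding (X Y : C) : inl X Y ≫ (β_ X Y).hom = inr Y X := by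
  simp [inl, inr, BraidedCategory.braiding_naturality_right]

theorem inr_braiding (X Y : C) : inr X Y ≫ (β_ X Y).hom = inl Y X := by
  simp [inl, inr, BraidedCategory.braiding_naturality_left]

/-- By coherence of the unitors, the outer injection followed by the associator is `X ◁ inl Y Z`;
the cobang of `Y` then absorbs `inl Y Z`. -/
theorem inl_inl_associator (X Y Z : C) :
    inl X Y ≫ inl (X ⊗ Y) Z ≫ (α_ X Y Z).hom = inl X (Y ⊗ Z) := by
  have h : (ρ_ (X ⊗ Y)).inv ≫ (X ⊗ Y) ◁ η[Z] ≫ (α_ X Y Z).hom = X ◁ inl Y Z := by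
    simp [inl]
  rw [inl, inl, Category.assoc, Category.assoc, h, ← whiskerLeft_comp,
    FiniteCoproductCategory.cobang_naturality, inl]

theorem inr_associator (X Y Z : C) :
    inr (X ⊗ Y) Z ≫ (α_ X Y Z).hom = inr Y Z ≫ inr X (Y ⊗ Z) := by
  have h : inr X (Y ⊗ Z) = inr X Y ▷ Z ≫ (α_ X Y Z).hom := by simp [inr]
  rw [h, inr, inr, Category.assoc, Category.assoc, ← comp_whiskerRight_assoc,
    FiniteCoproductCategory.cobang_naturality]

theorem inr_inl_associator (X Y Z : C) :
    inr X Y ≫ inl (X ⊗ Y) Z ≫ (α_ X Y Z).hom = inl Y Z ≫ inr X (Y ⊗ Z) := by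
  have h : (ρ_ (X ⊗ Y)).inv ≫ (X ⊗ Y) ◁ η[Z] ≫ (α_ X Y Z).hom = X ◁ inl Y Z := by
    simp [inl]
  rw [inl, Category.assoc, h, inr_whiskerLeft]

theorem inl_codiag (X : C) : inl X X ≫ μ[X] = 𝟙 X := by simp [inl]

theorem inr_codiag (X : C) : inr X X ≫ μ[X] = 𝟙 X := by simp [inr]

variable {D : Type u₂} [Category.{v₂} D] [MonoidalCategory D] [SymmetricCategory D]
  [FiniteCoproductCategory D]

/-- The comparison map of a functor between finite coproduct categories. -/
def sumComparison (F : C ⥤ D) (X Y : C) : F.obj X ⊗ F.obj Y ⟶ F.obj (X ⊗ Y) :=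
  copair (F.map (inl X Y)) (F.map (inr X Y))

theorem inl_sumComparison (F : C ⥤ D) (X Y : C) :
    inl _ _ ≫ sumComparison F X Y = F.map (inl X Y) := inl_copair _ _

theorem inr_sumComparison (F : C ⥤ D) (X Y : C) :
    inr _ _ ≫ sumComparison F X Y = F.map (inr X Y) := inr_copair _ _

/-- Transfers invertibility of the comparison arrows between isomorphic functors. -/
theorem sumComparison_natIso {F G : C ⥤ D} (e : F ≅ G) (X Y : C) :
    sumComparison F X Y =
      (e.hom.app X ⊗ₘ e.hom.app Y) ≫ sumComparison G X Y ≫ e.inv.app (X ⊗ Y) := by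
  apply sum_hom_ext
  · simp [reassoc_of% inl_tensorHom, reassoc_of% inl_sumComparison, inl_sumComparison]
  · simp [reassoc_of% inr_tensorHom, reassoc_of% inr_sumComparison, inr_sumComparison]

/-- A functor between finite coproduct categories whose comparison maps are invertible is strong
monoidal. -/
@[reducible]
noncomputable def coreMonoidalOfComparison (F : C ⥤ D) (h₀ : IsIso (η[F.obj (𝟙_ C)]))
    (h : ∀ X Y, IsIso (sumComparison F X Y)) : F.CoreMonoidal where
  εIso := asIso η[F.obj (𝟙_ C)]
  μIso X Y := asIso (sumComparison F X Y)
  μIso_hom_natural_left f X' := by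
    -- Each monoidal axiom equates two arrows out of a sum. Along an injection, both sides become
    -- the image under `F` of an injection; a unit summand is handled by initiality.
    apply sum_hom_ext
    · simp only [asIso_hom, reassoc_of% inl_whiskerRight, reassoc_of% inl_sumComparison,
        inl_sumComparison, ← F.map_comp, inl_whiskerRight]
    · simp only [asIso_hom, reassoc_of% inr_whiskerRight, reassoc_of% inr_sumComparison,
        inr_sumComparison, ← F.map_comp, inr_whiskerRight]
  μIso_hom_natural_right X' f := by
    apply sum_hom_ext
    · simp only [asIso_hom, reassoc_of% inl_whiskerLeft, reassoc_of% inl_sumComparison,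
        inl_sumComparison, ← F.map_comp, inl_whiskerLeft]
    · simp only [asIso_hom, reassoc_of% inr_whiskerLeft, reassoc_of% inr_sumComparison,
        inr_sumComparison, ← F.map_comp, inr_whiskerLeft]
  associativity X Y Z := by
    refine sum_hom_ext (sum_hom_ext ?_ ?_) ?_
    · simp only [asIso_hom, reassoc_of% inl_whiskerRight, reassoc_of% inl_sumComparison,
        reassoc_of% inl_inl_associator, reassoc_of% inl_whiskerLeft, inl_sumComparison,
        ← F.map_comp, inl_inl_associator]
    · simp only [asIso_hom, reassoc_of% inl_whiskerRight, reassoc_of% inr_sumComparison,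
        reassoc_of% inl_sumComparison, reassoc_of% inr_inl_associator,
        reassoc_of% inr_whiskerLeft, inr_sumComparison, ← F.map_comp, inr_inl_associator]
    · simp only [asIso_hom, reassoc_of% inr_whiskerRight, reassoc_of% inr_sumComparison,
        reassoc_of% inr_associator, reassoc_of% inr_whiskerLeft, inr_sumComparison,
        ← F.map_comp, inr_associator]
  left_unitality X := by
    refine sum_hom_ext (unit_hom_ext _ _) ?_
    simp only [asIso_hom, reassoc_of% inr_whiskerRight, reassoc_of% inr_sumComparison,
      inr_leftUnitor, ← F.map_comp, F.map_id]
  right_unitality X := by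
    refine sum_hom_ext ?_ (unit_hom_ext _ _)
    simp only [asIso_hom, reassoc_of% inl_whiskerLeft, reassoc_of% inl_sumComparison,
      inl_rightUnitor, ← F.map_comp, F.map_id]

/-- A functor between finite coproduct categories whose comparison maps are invertible is a
morphism of finite coproduct categories. -/
noncomputable def FCFunctor.ofComparison (F : C ⥤ D) (h₀ : IsIso (η[F.obj (𝟙_ C)]))
    (h : ∀ X Y, IsIso (sumComparison F X Y)) : FCFunctor C D where
  toFunctor := F
  braided :=
    { toMonoidal := (coreMonoidalOfComparison F h₀ h).toMonoidal
      braided X Y := by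
        change sumComparison F X Y ≫ F.map (β_ X Y).hom = (β_ _ _).hom ≫ sumComparison F Y X
        apply sum_hom_ext
        · simp only [reassoc_of% inl_sumComparison, reassoc_of% inl_braiding, inr_sumComparison,
            ← F.map_comp, inl_braiding]
        · simp only [reassoc_of% inr_sumComparison, reassoc_of% inr_braiding, inl_sumComparison,
            ← F.map_comp, inr_braiding] }
  map_codiag X := by
    change sumComparison F X X ≫ F.map μ[X] = μ[F.obj X]
    apply sum_hom_ext
    · rw [reassoc_of% inl_sumComparison, ← F.map_comp, inl_codiag, inl_codiag, F.map_id]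
    · rw [reassoc_of% inr_sumComparison, ← F.map_comp, inr_codiag, inr_codiag, F.map_id]
  map_cobang X := unit_hom_ext _ _

end FCLemmas
end TRig

namespace TRig

/-! ### Disjoint union as an fc structure on the Kleisli category. -/

section KleisliFC

open scoped MonObj

variable {M : Monad (Type u)}

/-! The functions which give the commutative monoids for `⊕`. -/

def codiagFun (X : Kleisli M) : (X ⊕ₒ X).of → X.of := Sum.elim id id
def cobangFun (X : Kleisli M) : (sumZero (Kleisli M)).of → X.of := PEmpty.elim

theorem codiagFun_naturality {X Y : Kleisli M} (f : X ⟶ Y) :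
    pureHom M (codiagFun X) ≫ f = (f ⊕ₘ f) ≫ pureHom M (codiagFun Y) := by
  have hl (Z : Kleisli M) : kinl Z Z ≫ pureHom M (codiagFun Z) = 𝟙 Z :=
    (pureHom_comp _ _).trans (pureHom_id Z)
  have hr (Z : Kleisli M) : kinr Z Z ≫ pureHom M (codiagFun Z) = 𝟙 Z :=
    (pureHom_comp _ _).trans (pureHom_id Z)
  apply ksum_ext
  · rw [reassoc_of% hl]
    -- The identity after `f` is then expanded to an injection followed by the codiagonal, so that
    -- `kinl_kmap` can move the injection before `f ⊕ f`.
    refine (Category.comp_id f).symm.trans ?_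
    rw [← hl, ← Category.assoc, ← kinl_kmap f f, Category.assoc]
    rfl
  · rw [reassoc_of% hr]
    refine (Category.comp_id f).symm.trans ?_
    rw [← hr, ← Category.assoc, ← kinr_kmap f f, Category.assoc]
    rfl

/-- The monoid structure of an object of the Kleisli category with respect to `⊕`. -/
@[reducible]
def kleisliMon (X : Kleisli M) : @MonObj (Kleisli M) _ (kleisliSum M) X :=
  letI := kleisliSum M
  { one := pureHom M (cobangFun X)
    mul := pureHom M (codiagFun X)
    one_mul := by
      change (pureHom M (cobangFun X) ⊕ₘ 𝟙 X) ≫ pureHom M (codiagFun X) = (sumLeft X).hom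
      rw [sumHom_pureHom_id, pureHom_comp, sumLeft_hom_eq]
      refine pureHom_congr ?_
      rintro (x | x)
      · exact x.elim
      · rfl
    mul_one := by
      change (𝟙 X ⊕ₘ pureHom M (cobangFun X)) ≫ pureHom M (codiagFun X) = (sumRight X).hom
      rw [sumHom_id_pureHom, pureHom_comp, sumRight_hom_eq]
      refine pureHom_congr ?_
      rintro (x | x)
      · rfl
      · exact x.elim
    mul_assoc := by
      change (pureHom M (codiagFun X) ⊕ₘ 𝟙 X) ≫ pureHom M (codiagFun X) =
        (sumAssoc X X X).hom ≫ (𝟙 X ⊕ₘ pureHom M (codiagFun X)) ≫ pureHom M (codiagFun X)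
      rw [sumHom_id_pureHom, sumHom_pureHom_id, pureHom_comp, pureHom_comp, sumAssoc_hom_eq,
        pureHom_comp]
      refine pureHom_congr ?_
      rintro ((x | x) | x) <;> rfl }

variable (M) in
/-- The Kleisli category of a monad on sets with disjoint unions is a finite coproduct
category. -/
@[reducible]
def kleisliFC : SumIsFC (Kleisli M) :=
  letI := kleisliSum M
  letI : SymmetricCategory (Kleisli M) := kleisliSymmetricSum.symmetric
  { monObj := kleisliMon
    isCommMonObj := fun X =>
      letI := kleisliMon X
      { mul_comm := by
          change (sumBraid X X).hom ≫ pureHom M (codiagFun X) = pureHom M (codiagFun X)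
          rw [sumBraid_hom_eq, pureHom_comp]
          refine pureHom_congr ?_
          rintro (x | x) <;> rfl }
    codiag_tensor := fun X Y => by
      change pureHom M (codiagFun (X ⊕ₒ Y)) =
        sumMid X Y X Y ≫ (pureHom M (codiagFun X) ⊕ₘ pureHom M (codiagFun Y))
      rw [sumMid_eq, sumHom_pureHom, pureHom_comp]
      refine pureHom_congr ?_
      rintro ((x | x) | (x | x)) <;> rfl
    cobang_tensor := fun X Y => kempty_ext _ _
    codiag_unit := by
      change pureHom M (codiagFun (sumZero _)) = (sumLeft (sumZero _)).hom
      rw [sumLeft_hom_eq]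
      refine pureHom_congr ?_
      rintro (x | x) <;> exact x.elim
    cobang_unit := kempty_ext _ _
    codiag_naturality := codiagFun_naturality
    cobang_naturality := fun f => kempty_ext _ _ }

end KleisliFC

/-! ### Copy and discard on sums. -/

section FCCD

variable {M : Monad (Type u)} [N : SymmetricMonoidalMonad M]

variable (M) in
/-- The Kleisli category of a symmetric monoidal monad on sets as a finite coproduct-copy discard
rig category. -/
@[reducible]
def kleisliFCCDRig : FCCDRigCategory (Kleisli M) where
  cd := kleisliCopyDiscard M
  fc := kleisliFC M
  rig := kleisliRig M
  discard_sum X Y := by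
    simp only [ComonObj.counit, sumHom_pureHom]
    change _ = _ ≫ pureHom M (codiagFun (𝟙_ (Kleisli M)))
    rw [pureHom_comp]
    refine pureHom_congr ?_
    rintro (x | x) <;> rfl
  copy_sum X Y := by
    -- All factors, including the inverse distributors, are now visible as images of functions. An
    -- element of either summand is copied inside its own diagonal block and never meets the
    -- cobangs.
    change pureHom M (Y := (X ⊕ₒ Y) ⊗ (X ⊕ₒ Y)) (fun x => (x, x)) =
      ((sumRight X).inv ⊕ₘ (sumLeft Y).inv) ≫
        ((pureHom M (Y := X ⊗ X) (fun x => (x, x)) ⊕ₘ pureHom M (cobangFun (X ⊗ Y))) ⊕ₘ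
          (pureHom M (cobangFun (Y ⊗ X)) ⊕ₘ pureHom M (Y := Y ⊗ Y) (fun x => (x, x)))) ≫
          ((kdl X X Y).inv ⊕ₘ (kdl Y X Y).inv) ≫ (kdr X Y (X ⊕ₒ Y)).inv
    simp only [sumRight_inv_eq, sumLeft_inv_eq, kdl_inv_eq, kdr_inv_eq, sumHom_pureHom,
      pureHom_comp]
    refine pureHom_congr ?_
    rintro (x | x) <;> rfl

end FCCD

end TRig

namespace TRig

/-! ### The embedding of the opposite Lawvere theory. -/

section LawvereFunctor

variable {T : AlgebraicTheory.{u}}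

/-- Renaming variables back along `g` undoes the renaming along `f`. With `f = ULift.up` this gives
faithfulness. -/
theorem Cls.bind_injective {X Y : Type*} {f : X → Y} {g : Y → X} (h : ∀ x, g (f x) = x) :
    Function.Injective (Cls.bind (T := T) fun x => Cls.var (f x)) := by
  refine Function.LeftInverse.injective (g := Cls.bind fun y => Cls.var (g y)) fun c => ?_
  simp only [Cls.bind_bind, Cls.bind_var, h, Cls.var_bind]

instance lawvereToKleisli_faithful : (lawvereToKleisli T).Faithful where
  map_injective {n m} s t h := by
    refine Quiver.Hom.unop_inj (funext fun i => ?_)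
    exact Cls.bind_injective (T := T) (f := ULift.up.{u}) (g := ULift.down) (fun _ => rfl)
      (congrArg (fun k : (lawvereToKleisli T).obj n ⟶ (lawvereToKleisli T).obj m =>
        k.of (ULift.up i)) h)

instance lawvereToKleisli_full : (lawvereToKleisli T).Full where
  map_surjective {n m} f := by
    -- The preimage renames variables along `ULift.down`, inverse to the renaming along `ULift.up`
    -- in the functor.
    refine ⟨Quiver.Hom.op (show m.unop ⟶ n.unop from fun i =>
      Cls.bind (fun j : ULift.{u} (Fin m.unop.len) => Cls.var j.down) (f.of (ULift.up i))), ?_⟩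
    apply Kleisli.hom_ext
    ext i
    change Cls.bind _ (Cls.bind _ _) = _
    exact (Cls.bind_bind _ _ _).trans (Cls.var_bind (X := ULift.{u} (Fin m.unop.len)) _)

theorem lawvereToKleisli_obj_injective : Function.Injective (lawvereToKleisli T).obj := by
  intro n m h
  have h₁ : ULift.{u} (Fin n.unop.len) = ULift.{u} (Fin m.unop.len) := congrArg Kleisli.of h
  -- An equality of underlying types determines the ordinal only through its cardinality.
  have h₂ : n.unop.len = m.unop.len := by
    have := Fintype.card_congr (Equiv.cast h₁)
    simpa using this
  obtain ⟨⟨n⟩⟩ := n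
  obtain ⟨⟨m⟩⟩ := m
  exact congrArg (fun k => Opposite.op (Lawvere.mk k)) h₂

theorem ordToLawvere_comp_lawvereToKleisli :
    ordToLawvere T ⋙ lawvereToKleisli T =
      ordToSet ⋙ Kleisli.Adjunction.toKleisli (termMonad T) :=
  rfl

end LawvereFunctor

/-! ### Iterated sums of the singleton and finite ordinals; `⊗` denotes disjoint union here. -/

section FiniteOrdinals

variable {M : Monad (Type u)}

attribute [local instance] kleisliSum kleisliFC

@[reducible]
def kleisliSumSymmetric : SymmetricCategory (Kleisli M) := kleisliSymmetricSum.symmetric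

attribute [local instance] kleisliSumSymmetric

theorem inl_eq_kinl (X Y : Kleisli M) : inl X Y = kinl X Y := by
  change (sumRight X).inv ≫ (𝟙 X ⊕ₘ pureHom M (cobangFun Y)) = _
  rw [sumHom_id_pureHom, sumRight_inv_eq, pureHom_comp]
  rfl

theorem inr_eq_kinr (X Y : Kleisli M) : inr X Y = kinr X Y := by
  change (sumLeft Y).inv ≫ (pureHom M (cobangFun X) ⊕ₘ 𝟙 Y) = _
  rw [sumHom_pureHom_id, sumLeft_inv_eq, pureHom_comp]
  rfl

/-- The arrow `1 ⟶ {0, …, n-1}` given by an element. -/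
def ordPoint {n : ℕ} (k : Fin n) : Kleisli.mk M PUnit.{u + 1} ⟶ .mk M (ULift.{u} (Fin n)) :=
  pureHom M (X := .mk M PUnit.{u + 1}) (Y := .mk M (ULift.{u} (Fin n))) fun _ => ULift.up k

/-- Together with `ordDesc`, this makes the ordinal `n` a coproduct of `n` singletons in the Kleisli
category. -/
theorem ord_hom_ext {n : ℕ} {Z : Kleisli M} {f g : Kleisli.mk M (ULift.{u} (Fin n)) ⟶ Z}
    (h : ∀ k : Fin n, ordPoint k ≫ f = ordPoint k ≫ g) : f = g := by
  apply Kleisli.hom_ext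
  ext ⟨k⟩
  have := congrArg (fun l : Kleisli.mk M PUnit ⟶ Z => l.of PUnit.unit) (h k)
  have e (l : Kleisli.mk M (ULift.{u} (Fin n)) ⟶ Z) :
      (ordPoint k ≫ l).of PUnit.unit = l.of (ULift.up k) :=
    pureHom_comp_apply (Y := .mk M (ULift.{u} (Fin n))) _ l _
  exact (e f).symm.trans (this.trans (e g))

/-- The tuple of the values of a family of arrows `1 ⟶ Z`. -/
def ordDesc {n : ℕ} {Z : Kleisli M} (g : Fin n → (Kleisli.mk M PUnit ⟶ Z)) :
    Kleisli.mk M (ULift.{u} (Fin n)) ⟶ Z :=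
  .mk (↾fun i => (g i.down).of PUnit.unit)

theorem pureHom_ordDesc {n : ℕ} {Z : Kleisli M} (g : Fin n → (Kleisli.mk M PUnit ⟶ Z))
    (k : Fin n) : ordPoint k ≫ ordDesc g = g k := by
  apply Kleisli.hom_ext
  ext x
  exact pureHom_comp_apply (Y := .mk M (ULift.{u} (Fin n))) _ (ordDesc g) x

/-- The canonical isomorphism from the `n`-fold sum of the singleton to the ordinal `n`. -/
def nsumIsoOrd (n : ℕ) : nsum (Kleisli.mk M PUnit.{u + 1}) n ≅ .mk M (ULift.{u} (Fin n)) where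
  -- Both objects are `n`-fold coproducts of the singleton, so the two cotuples of injections are
  -- mutually inverse.
  hom := nsumDesc n ordPoint
  inv := ordDesc (nsumInj _ n)
  hom_inv_id := by
    rw [nsumDesc_comp]
    simp only [pureHom_ordDesc]
    exact nsumDesc_inj _ n
  inv_hom_id := ord_hom_ext fun k => by
    rw [← Category.assoc, pureHom_ordDesc, nsumInj_desc, Category.comp_id]

theorem nsumInj_nsumIsoOrd_hom (n : ℕ) (k : Fin n) :
    nsumInj (Kleisli.mk M PUnit.{u + 1}) n k ≫ (nsumIsoOrd n).hom = ordPoint k :=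
  nsumInj_desc _ _ _

/-- The action on arrows in `i ∘ d = c`: the left side is how the conjugated functor acts on a tuple
of variables, the right side is `copower`. -/
theorem nsumIsoOrd_conj {n m : ℕ} (f : Fin n → Fin m) :
    (nsumIsoOrd (M := M) n).hom ≫
      pureHom M (X := .mk M (ULift.{u} (Fin n))) (Y := .mk M (ULift.{u} (Fin m)))
        (fun i => ULift.up (f i.down)) ≫ (nsumIsoOrd m).inv =
      nsumDesc n fun k => nsumInj _ m (f k) := by
  refine (nsumDesc_comp _ _ _).trans (congrArg _ (funext fun k => ?_))
  rw [← Category.assoc, ordPoint, pureHom_comp]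
  exact pureHom_ordDesc _ _

end FiniteOrdinals

/-! ### `lawvereToKleisli` and its strict replacement as morphisms of fc categories. -/

section Morphisms

variable (T : AlgebraicTheory.{u})

attribute [local instance] kleisliSum kleisliFC kleisliSumSymmetric

open scoped MonObj

theorem isIso_cobang_lawvereToKleisli : IsIso η[(lawvereToKleisli T).obj (𝟙_ (Lawvere T)ᵒᵖ)] :=
  inferInstanceAs (IsIso (pureIso (termMonad T) (X := sumZero _)
    (Y := .mk _ (ULift.{u} (Fin 0)))
      ⟨PEmpty.elim, fun i => i.down.elim0, fun i => i.elim, fun i => i.down.elim0⟩).hom)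

/-- Dually, discarding the second factor and applying the unitor is the first projection, which in
the Lawvere theory is a tuple of variables. -/
theorem inl_lawvere (n m : ℕ) : inl (Opposite.op (Lawvere.mk (T := T) n)) (.op ⟨m⟩) =
    Quiver.Hom.op (show (⟨n + m⟩ : Lawvere T) ⟶ ⟨n⟩ from fun i => Cls.var (Fin.castAdd m i)) := by
  refine Quiver.Hom.unop_inj ?_
  exact CartesianMonoidalCategory.whiskerLeft_toUnit_comp_rightUnitor_hom
    (Lawvere.mk (T := T) n) ⟨m⟩

theorem inr_lawvere (n m : ℕ) : inr (Opposite.op (Lawvere.mk (T := T) n)) (.op ⟨m⟩) =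
    Quiver.Hom.op (show (⟨n + m⟩ : Lawvere T) ⟶ ⟨m⟩ from fun i => Cls.var (Fin.natAdd n i)) := by
  refine Quiver.Hom.unop_inj ?_
  exact CartesianMonoidalCategory.whiskerRight_toUnit_comp_leftUnitor_hom
    (Lawvere.mk (T := T) n) ⟨m⟩

/-- The bijection between the sum of two ordinals and their disjoint union. -/
def ordSumEquiv (n m : ℕ) :
    ULift.{u} (Fin n) ⊕ ULift.{u} (Fin m) ≃ ULift.{u} (Fin (n + m)) :=
  (Equiv.sumCongr Equiv.ulift Equiv.ulift).trans (finSumFinEquiv.trans Equiv.ulift.symm)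

theorem isIso_sumComparison_lawvereToKleisli (X Y : (Lawvere T)ᵒᵖ) :
    IsIso (sumComparison (lawvereToKleisli T) X Y) := by
  obtain ⟨⟨n⟩⟩ := X
  obtain ⟨⟨m⟩⟩ := Y
  have h : sumComparison (lawvereToKleisli T) (.op ⟨n⟩) (.op ⟨m⟩) =
      (pureIso (termMonad T) (X := ksum (.mk _ (ULift.{u} (Fin n))) (.mk _ (ULift.{u} (Fin m))))
        (Y := .mk _ (ULift.{u} (Fin (n + m)))) (ordSumEquiv n m)).hom := by
    -- On the two injections both sides are the inclusions of `n` and `m` as the initial and final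
    -- segments of `n + m`.
    apply sum_hom_ext
    · rw [inl_sumComparison, inl_lawvere, inl_eq_kinl]
      exact (pureHom_comp (X := .mk _ (ULift.{u} (Fin n)))
        (Z := .mk _ (ULift.{u} (Fin (n + m)))) Sum.inl (ordSumEquiv n m)).symm
    · rw [inr_sumComparison, inr_lawvere, inr_eq_kinr]
      exact (pureHom_comp (X := .mk _ (ULift.{u} (Fin m)))
        (Z := .mk _ (ULift.{u} (Fin (n + m)))) Sum.inr (ordSumEquiv n m)).symm
  rw [h]
  exact Iso.isIso_hom _

/-- The embedding of the opposite of the Lawvere theory, with values in iterated sums of the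
singleton. -/
noncomputable def lawvereToSums : (Lawvere T)ᵒᵖ ⥤ Kleisli (termMonad T) :=
  -- `copyObj` prescribes the objects and conjugates the arrows, so the values are iterated sums by
  -- definition.
  (lawvereToKleisli T).copyObj (fun n => nsum (.mk _ PUnit) n.unop.len)
    fun n => (nsumIsoOrd n.unop.len).symm

noncomputable def lawvereToSumsIso : lawvereToSums T ≅ lawvereToKleisli T :=
  ((lawvereToKleisli T).isoCopyObj _ _).symm

/-- `lawvereToKleisli T` as a morphism of finite coproduct categories. -/
noncomputable def lawvereToKleisliFC : SumFCFunctor (Lawvere T)ᵒᵖ (Kleisli (termMonad T)) :=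
  FCFunctor.ofComparison (lawvereToKleisli T) (isIso_cobang_lawvereToKleisli T)
    (isIso_sumComparison_lawvereToKleisli T)

/-- `lawvereToSums T` as a morphism of finite coproduct categories. -/
noncomputable def lawvereToSumsFC : SumFCFunctor (Lawvere T)ᵒᵖ (Kleisli (termMonad T)) :=
  FCFunctor.ofComparison (lawvereToSums T)
    (by
      have := isIso_cobang_lawvereToKleisli T
      -- By naturality, the cobang of the new value is the invertible cobang of the old one followed
      -- by a component of the isomorphism.
      rw [← FiniteCoproductCategory.cobang_naturality ((lawvereToSumsIso T).inv.app _)]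
      infer_instance)
    (fun X Y => by
      have := isIso_sumComparison_lawvereToKleisli T X Y
      rw [sumComparison_natIso (lawvereToSumsIso T)]
      infer_instance)

/-- The objects agree by definition, so the heterogeneous equality of arrows is an ordinary one. -/
theorem ordToLawvere_comp_lawvereToSums :
    ordToLawvere T ⋙ lawvereToSums T = copower (.mk _ PUnit) :=
  Functor.hext (fun _ => rfl) fun _ _ f => heq_of_eq (nsumIsoOrd_conj f)

end Morphisms

/-! ### Assembly of the structure. -/

section Standard

variable (T : AlgebraicTheory.{u}) [SymmetricMonoidalMonad (termMonad T)]

/-- The Kleisli category of the term monad as a `T`-copy discard rig category. -/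
noncomputable def kleisliTCDRig : TCDRigCategory T (Kleisli (termMonad T)) where
  fccd := kleisliFCCDRig (termMonad T)
  tRig :=
    letI := kleisliFC (termMonad T)
    { i := lawvereToSumsFC T
      comm := ordToLawvere_comp_lawvereToSums T }

theorem isStandard_kleisliTCDRig : IsStandard (kleisliTCDRig T) where
  braid _ _ := rfl
  copy _ := rfl
  discard _ := rfl
  codiag _ := rfl
  cobang _ := rfl
  dl _ _ _ := rfl
  dr _ _ _ := rfl
  annl _ := rfl
  annr _ := rfl

end Standard

end TRig

theorem mainTheorem3 (T : AlgebraicTheory.{u}) [SymmetricMonoidalMonad (termMonad T)] :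
    ∃ R : TCDRigCategory T (Kleisli (termMonad T)), IsStandard R ∧
      (lawvereToKleisli T).Full ∧ (lawvereToKleisli T).Faithful ∧
      Function.Injective (lawvereToKleisli T).obj ∧
      ordToLawvere T ⋙ lawvereToKleisli T =
        ordToSet ⋙ Kleisli.Adjunction.toKleisli (termMonad T) ∧
      letI := R.fccd.fc
      (∃ j : SumFCFunctor (Lawvere T)ᵒᵖ (Kleisli (termMonad T)),
        j.functor = lawvereToKleisli T) ∧
      ∃ e : R.tRig.i.functor ≅ lawvereToKleisli T, ∀ (n : ℕ) (k : Fin n),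
        sumInj (𝟙_ (Kleisli (termMonad T))) n k ≫ eqToHom (R.tRig.obj_eq n).symm ≫
          e.hom.app (.op ⟨n⟩) = pureHom _ fun _ => ULift.up k := by
  refine ⟨kleisliTCDRig T, isStandard_kleisliTCDRig T, inferInstance, inferInstance,
    lawvereToKleisli_obj_injective, ordToLawvere_comp_lawvereToKleisli,
    ⟨lawvereToKleisliFC T, rfl⟩, lawvereToSumsIso T, fun n k => ?_⟩
  refine Eq.trans ?_ (nsumInj_nsumIsoOrd_hom n k)
  -- For this structure `obj_eq` relates objects equal by definition, so `eqToHom` is an identity,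
  -- and the component of the isomorphism at `n` is `nsumIsoOrd n`.
  exact congrArg (_ ≫ ·) (Category.id_comp _)
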